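/- Let $r,n\ge 1$ be integers, let $\alpha\in\mathbb F_{2^r}^\times$, and let $C_{3,\alpha}$ be the projective plane curve over $\mathbb F_{2^r}$ with affine equation $$y^2+y=\alpha\,(x^{2^{r+1}+1}+x^{2^r+2}+x^{2^r+1}+x^2).$$ Let $N=\#C_{3,\alpha}(\mathbb F_{2^{rn}})$ be its number of $\mathbb F_{2^{rn}}$-rational points in $\mathbb P^2$ (so the point at infinity is included). Roots of $x^3+x+\alpha^{-1}$ are counted in $\mathbb F_{2^r}$ (they are always distinct). (1) If $r$ is odd and $x^3+x+\alpha^{-1}$ has three roots in $\mathbb F_{2^r}$, then $$N=\begin{cases}(2^{rn}+1)+2^{r(n+1)/2}& n\equiv 1,7 \pmod 8,\\ (2^{rn}+1)-2^{r(n+1)/2}& n\equiv 3,5 \pmod 8,\\ 2^{rn}+1& n\equiv 2,6 \pmod 8,\\ (2^{rn}+1)+2^{r(n+2)/2+1}& n\equiv 4 \pmod 8,\\ (2^{rn}+1)-2^{r(n+2)/2+1}& n\equiv 0 \pmod 8.\end{cases}$$ (2) If $r$ is even and $x^3+x+\alpha^{-1}$ has three roots in $\mathbb F_{2^r}$, then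 $$N=\begin{cases}(2^{rn}+1)+2^{r(n+1)/2}& n\equiv 1,3,5,7 \pmod 8,\\ 2^{rn}+1& n\equiv 2,6 \pmod 8,\\ (2^{rn}+1)-2^{r(n+2)/2+1}& n\equiv 0,4 \pmod 8.\end{cases}$$ (3) If $r$ is odd and $x^3+x+\alpha^{-1}$ has exactly one root in $\mathbb F_{2^r}$, then $$N=\begin{cases}(2^{rn}+1)+2^{r(n+1)/2}& n\equiv 1,7 \pmod 8,\\ (2^{rn}+1)-2^{r(n+1)/2}& n\equiv 3,5 \pmod 8,\\ 2^{rn}+1& n\equiv 2,4,6 \pmod 8,\\ (2^{rn}+1)-2^{r(n+2)/2+1}& n\equiv 0 \pmod 8.\end{cases}$$ (4) If $r$ is even and $x^3+x+\alpha^{-1}$ has exactly one root in $\mathbb F_{2^r}$, then $$N=\begin{cases}(2^{rn}+1)+2^{r(n+1)/2}& n\equiv 1,3,5,7 \pmod 8,\\ 2^{rn}+1& n\equiv 2,4,6 \pmod 8,\\ (2^{rn}+1)-2^{r(n+2)/2+1}& n\equiv 0 \pmod 8.\end{cases}$$ (5) If $r$ is odd and $x^3+x+\alpha^{-1}$ has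 no root in $\mathbb F_{2^r}$, then $$N=\begin{cases}(2^{rn}+1)+2^{r(n+1)/2}& n\equiv 1,7,17,23 \pmod{24},\\ (2^{rn}+1)-2^{r(n+1)/2}& n\equiv 5,11,13,19 \pmod{24},\\ (2^{rn}+1)+2^{r(n+1)/2+1}& n\equiv 3,21 \pmod{24},\\ (2^{rn}+1)-2^{r(n+1)/2+1}& n\equiv 9,15 \pmod{24},\\ 2^{rn}+1& n\equiv 2,6,10,14,18,22 \pmod{24},\\ (2^{rn}+1)+2^{r(n+2)/2}& n\equiv 8,16 \pmod{24},\\ (2^{rn}+1)-2^{r(n+2)/2}& n\equiv 4,20 \pmod{24},\\ (2^{rn}+1)+2^{r(n+2)/2+1}& n\equiv 12 \pmod{24},\\ (2^{rn}+1)-2^{r(n+2)/2+1}& n\equiv 0 \pmod{24}.\end{cases}$$ (6) If $r$ is even and $x^3+x+\alpha^{-1}$ has no root in $\mathbb F_{2^r}$, then $$N=\begin{cases}(2^{rn}+1)+2^{r(n+1)/2}& n\equiv 1,5,7,11,13,17,19,23 \pmod{24},\\ (2^{rn}+1)-2^{r(n+1)/2+1}& n\equiv 3,9,15,21 \pmod{24},\\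 2^{rn}+1& n\equiv 2,6,10,14,18,22 \pmod{24},\\ (2^{rn}+1)+2^{r(n+2)/2}& n\equiv 4,8,16,20 \pmod{24},\\ (2^{rn}+1)-2^{r(n+2)/2+1}& n\equiv 0,12 \pmod{24}.\end{cases}$$ -/

import Mathlib

/-- The homogeneous equation (of degree `2 ^ (r + 1) + 1`) of the projective closure of the affine
plane curve `y ^ 2 + y = a * (x ^ (2 ^ (r + 1) + 1) + x ^ (2 ^ r + 2) + x ^ (2 ^ r + 1) + x ^ 2)`,
evaluated at `v = (X, Y, Z)` with `x = X / Z` and `y = Y / Z`. -/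
def C3Equation {K : Type*} [Field K] (r : ℕ) (a : K) (v : Fin 3 → K) : Prop :=
  v 1 ^ 2 * v 2 ^ (2 ^ (r + 1) - 1) + v 1 * v 2 ^ 2 ^ (r + 1) =
    a * (v 0 ^ (2 ^ (r + 1) + 1) + v 0 ^ (2 ^ r + 2) * v 2 ^ (2 ^ r - 1)
      + v 0 ^ (2 ^ r + 1) * v 2 ^ 2 ^ r + v 0 ^ 2 * v 2 ^ (2 ^ (r + 1) - 1))

/-- The set of `K`-rational points of the projective plane curve over `K` with affine equation
`y ^ 2 + y = a * (x ^ (2 ^ (r + 1) + 1) + x ^ (2 ^ r + 2) + x ^ (2 ^ r + 1) + x ^ 2)`. -/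
def C3Points {K : Type*} [Field K] (r : ℕ) (a : K) : Set (Projectivization K (Fin 3 → K)) :=
  {P | C3Equation r a P.rep}

theorem C3Equation_smul {K : Type*} [Field K] (r : ℕ) (a : K) (v : Fin 3 → K) {c : K}
    (hc : c ≠ 0) : C3Equation r a (c • v) ↔ C3Equation r a v := by
  obtain ⟨q, hq⟩ : ∃ q, 2 ^ r = q + 1 :=
    ⟨2 ^ r - 1, by have := Nat.one_le_two_pow (n := r); omega⟩
  have h2 : 2 ^ (r + 1) = 2 * q + 2 := by rw [pow_succ, hq]; ring
  have e1 : 2 * q + 2 - 1 = 2 * q + 1 := by omega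
  have e2 : q + 1 - 1 = q := by omega
  have hcq : c ^ (2 * q + 3) ≠ 0 := pow_ne_zero _ hc
  simp only [C3Equation, Pi.smul_apply, smul_eq_mul, h2, hq, e1, e2]
  constructor
  · intro h
    apply mul_left_cancel₀ hcq
    linear_combination h
  · intro h
    linear_combination c ^ (2 * q + 3) * h

/-- Membership does not depend on the chosen homogeneous coordinates. -/
theorem mk_mem_C3Points {K : Type*} [Field K] (r : ℕ) (a : K) (v : Fin 3 → K) (hv : v ≠ 0) :
    Projectivization.mk K v hv ∈ C3Points r a ↔ C3Equation r a v := by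
  obtain ⟨c, hc⟩ := Projectivization.exists_smul_eq_mk_rep K v hv
  change C3Equation r a (Projectivization.mk K v hv).rep ↔ _
  rw [← hc]
  exact C3Equation_smul r a v c.ne_zero

/-- The number of distinct roots of `x ^ 3 + x + α⁻¹` in `F`. -/
noncomputable def cubicRootCount {F : Type*} [Field F] (α : F) : ℕ :=
  {x : F | x ^ 3 + x + α⁻¹ = 0}.ncard

/-! Write q = 2^r, F = 𝔽_q, K = 𝔽_{q^n}, σ for the q-Frobenius, x' = σx. The fibre over x has 1 +
`asSign` points, so N = #K + 1 + S with S = `curveSum F K α α`, the sum over x of (-1)^{Tr Q(x)},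
where Q(x) = α(xx'(x + x') + xx' + x²) gives a quadratic form over 𝔽₂.

Size of S. The radical is {h : P(σ²h + h) = 0} with P(u) = α²u(u³ + u + α⁻¹), and S² is #K times the
sum of signs over the radical (`curveSum_sq`). If some sign there is -1, then S = 0; this happens
when n ≡ 2 mod 4. Otherwise S² = #K · #radical.

A root u of the cubic in F. Then α = AB = A + B² is solvable, and Q(x) has the sign of Q₀(Ax² + Bx),
where Q₀(z) = zz' + z². So S is the sum for Q₀ plus the same sum twisted by a linear character
attached to (u + 1)/u (`curveSum_self_of_root`). The sign of (u + 1)/u also decides whether the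
other two roots lie in F.

No root in F. The cubic has roots in K exactly when 3 ∣ n, and the radical is then four times
larger.

Sign of S. For odd n, a Galois action of order p gives a congruence mod p between S over K and S
over a subfield of index p (`curveSum_modEq`); with Euler's criterion for 2, this propagates the
sign χ₈(n)^r. For n = 4k, averaging over shifts leaves only terms of one sign
(`curveSum_sign_of_four_mul`). Without a root, the result involves the sign of α, which equals that
of 1 by Cardano's formula, and multiples of 3 are reached by the congruence mod 3. -/

open Finset

/-- The sign of the Artin–Schreier equation `y ^ 2 + y = x`: `1` if it is solvable, `-1` if not.
On a finite field of characteristic two this is the canonical additive character. -/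
noncomputable def asSign {k : Type*} [Field k] (x : k) : ℤ := by
  classical exact if ∃ y, y ^ 2 + y = x then 1 else -1

/-! ### The Artin–Schreier sign as an additive character. -/

section asSign

variable {k : Type*} [Field k]

theorem asSign_eq_one_iff {x : k} : asSign x = 1 ↔ ∃ y, y ^ 2 + y = x := by
  unfold asSign; split_ifs with h <;> simp [h]

theorem asSign_eq_one_or (x : k) : asSign x = 1 ∨ asSign x = -1 := by
  unfold asSign; split_ifs <;> simp

theorem asSign_eq_neg_one_iff {x : k} : asSign x = -1 ↔ ¬ ∃ y, y ^ 2 + y = x := by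
  unfold asSign; split_ifs with h <;> simp [h]

theorem asSign_mul_self (x : k) : asSign x * asSign x = 1 := by
  rcases asSign_eq_one_or x with h | h <;> simp [h]

@[simp] theorem asSign_zero : asSign (0 : k) = 1 := asSign_eq_one_iff.2 ⟨0, by simp⟩

theorem asSign_artinSchreier (y : k) : asSign (y ^ 2 + y) = 1 := asSign_eq_one_iff.2 ⟨y, rfl⟩

variable [CharP k 2]

/-- The Artin–Schreier map `y ↦ y ^ 2 + y`. -/
def artinSchreier (k : Type*) [Field k] [CharP k 2] : k →+ k where
  toFun y := y ^ 2 + y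
  map_zero' := by simp
  map_add' x y := by rw [CharTwo.add_sq]; ring

theorem artinSchreier_eq_iff {x y : k} : x ^ 2 + x = y ^ 2 + y ↔ x = y ∨ x = y + 1 := by
  have h2 : (2 : k) = 0 := CharTwo.two_eq_zero
  constructor
  · intro h
    have h' : (x + y) * (x + (y + 1)) = 0 := by linear_combination h + (x * y + y ^ 2 + y) * h2
    rcases mul_eq_zero.1 h' with h' | h'
    · exact Or.inl (CharTwo.add_eq_zero.1 h')
    · exact Or.inr (CharTwo.add_eq_zero.1 h')
  · rintro (rfl | rfl)
    · rfl
    · linear_combination (y + 1) * h2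

variable [Fintype k]

theorem card_artinSchreier_fiber [DecidableEq k] (x : k) :
    ((univ.filter fun y : k => y ^ 2 + y = x).card : ℤ) = 1 + asSign x := by
  by_cases h : ∃ y, y ^ 2 + y = x
  · rw [asSign_eq_one_iff.2 h]
    obtain ⟨y, rfl⟩ := h
    have : (univ.filter fun z : k => z ^ 2 + z = y ^ 2 + y) = {y, y + 1} := by
      ext z; simp [artinSchreier_eq_iff]
    rw [this, card_pair (by simp)]
    norm_num
  · rw [asSign_eq_neg_one_iff.2 h, filter_false_of_mem]
    · simp
    · intro y _ hy; exact h ⟨y, hy⟩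

theorem sum_asSign : ∑ x : k, asSign x = 0 := by
  classical
  have h1 : ∑ x : k, (1 + asSign x) = Fintype.card k := by
    simp_rw [← card_artinSchreier_fiber]
    rw [← Nat.cast_sum, ← card_univ, card_eq_sum_card_fiberwise (s := (univ : Finset k))
      (f := fun y => y ^ 2 + y) (t := univ) fun _ _ => mem_coe.2 (mem_univ _)]
  rw [sum_add_distrib] at h1
  simpa using h1

theorem exists_asSign_eq_neg_one (k : Type*) [Field k] [CharP k 2] [Finite k] :
    ∃ x : k, asSign x = -1 := by
  have := Fintype.ofFinite k
  by_contra! h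
  have h1 : ∀ x : k, asSign x = 1 := fun x => (asSign_eq_one_or x).resolve_right (h x)
  have := sum_asSign (k := k)
  simp [h1] at this

/-- The additive map y ↦ y² + y has kernel {0, 1}, so its image has index 2 and `asSign` is the
nontrivial character of the quotient. -/
theorem asSign_add (x y : k) : asSign (x + y) = asSign x * asSign y := by
  have key : (artinSchreier k).range.index = 2 := by
    have h0 : Nat.card (artinSchreier k).ker = 2 := by
      have : ((artinSchreier k).ker : Set k) = {0, 1} := by
        ext z
        have := artinSchreier_eq_iff (x := z) (y := 0)
        simpa [artinSchreier, AddMonoidHom.mem_ker] using this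
      rw [← SetLike.coe_sort_coe, this, Nat.card_coe_set_eq, Set.ncard_pair zero_ne_one]
    have h1 := (artinSchreier k).range.card_mul_index
    have h2 := (artinSchreier k).ker.card_mul_index
    rw [AddSubgroup.index_ker, h0] at h2
    have h3 : 0 < Nat.card (artinSchreier k).range := Nat.card_pos
    refine Nat.eq_of_mul_eq_mul_left h3 ?_
    rw [h1, ← h2, mul_comm]
  have hm : ∀ z : k, asSign z = 1 ↔ z ∈ (artinSchreier k).range := fun z => asSign_eq_one_iff
  have h := AddSubgroup.add_mem_iff_of_index_two key (a := x) (b := y)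
  rw [← hm, ← hm, ← hm] at h
  rcases asSign_eq_one_or x with hx | hx <;> rcases asSign_eq_one_or y with hy | hy <;>
    rcases asSign_eq_one_or (x + y) with hxy | hxy <;> simp [hx, hy, hxy] at h ⊢

theorem asSign_sq (x : k) : asSign (x ^ 2) = asSign x := by
  have h2 : (2 : k) = 0 := CharTwo.two_eq_zero
  have : x ^ 2 = (x ^ 2 + x) + x := by linear_combination -x * h2
  rw [this, asSign_add, asSign_artinSchreier, one_mul]

theorem sum_asSign_mul {c : k} (hc : c ≠ 0) : ∑ x : k, asSign (x * c) = 0 := by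
  rw [← sum_asSign (k := k)]
  exact Fintype.sum_bijective (· * c) (mulRight_bijective₀ c hc) _ _ fun _ => rfl

theorem sum_asSign_mul_eq_ite [DecidableEq k] (c : k) :
    ∑ x : k, asSign (x * c) = if c = 0 then (Fintype.card k : ℤ) else 0 := by
  split_ifs with h
  · simp [h]
  · exact sum_asSign_mul h

theorem sum_asSign_sq_mul_eq_ite [DecidableEq k] (c : k) :
    ∑ x : k, asSign (x ^ 2 * c) = if c = 0 then (Fintype.card k : ℤ) else 0 := by
  rw [← sum_asSign_mul_eq_ite c]
  exact Fintype.sum_bijective (· ^ 2) (frobenius_inj k 2).bijective_of_finite _ _ fun _ => rfl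

end asSign

/-! ### Frobenius, trace, and compatibility of the sign with both. -/

section trace

variable (F : Type*) {K : Type*} [Field F] [Field K] [Algebra F K] [Fintype F] [Fintype K]

/-- The Frobenius automorphism `x ↦ x ^ #F` of `K` over `F`. -/
noncomputable abbrev frob (K : Type*) [Field K] [Algebra F K] [Fintype K] : Gal(K/F) :=
  FiniteField.frobeniusAlgEquivOfAlgebraic F K

theorem frob_apply (x : K) : frob F K x = x ^ Fintype.card F := rfl

theorem frob_pow_finrank : frob F K ^ Module.finrank F K = 1 := by
  rw [← FiniteField.orderOf_frobeniusAlgEquivOfAlgebraic, pow_orderOf_eq_one]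

theorem frob_fixed_iff {x : K} : frob F K x = x ↔ ∃ c : F, algebraMap F K c = x := by
  constructor
  · intro h
    have hx : ∀ i : ℕ, (frob F K ^ i) x = x := by
      intro i
      induction i with
      | zero => rfl
      | succ i ih => rw [pow_succ, AlgEquiv.mul_apply, h, ih]
    have : x ∈ (⊥ : IntermediateField F K) := by
      rw [IsGalois.mem_bot_iff_fixed]
      intro g
      obtain ⟨i, hi⟩ := (FiniteField.bijective_frobeniusAlgEquivOfAlgebraic_pow F K).2 g
      rw [← hi]
      exact hx i
    exact IntermediateField.mem_bot.1 this
  · rintro ⟨c, rfl⟩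
    simp

theorem algebraMap_trace_eq_sum_frob (x : K) :
    algebraMap F K (Algebra.trace F K x) =
      ∑ i ∈ range (Module.finrank F K), (frob F K ^ i) x := by
  rw [FiniteField.algebraMap_trace_eq_sum_pow]
  refine sum_congr rfl fun i _ => ?_
  rw [AlgEquiv.coe_pow, FiniteField.coe_frobeniusAlgEquivOfAlgebraic_iterate,
    Fintype.card_eq_nat_card]

theorem trace_frob (x : K) : Algebra.trace F K (frob F K x) = Algebra.trace F K x :=
  Algebra.trace_eq_of_algEquiv (frob F K) x

variable [CharP K 2]

theorem trace_sq (x : K) : Algebra.trace F K (x ^ 2) = Algebra.trace F K x ^ 2 := by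
  apply (algebraMap F K).injective
  rw [RingHom.map_pow, algebraMap_trace_eq_sum_frob, algebraMap_trace_eq_sum_frob, CharTwo.sum_sq]
  simp

variable [CharP F 2]

/-- The trace commutes with squaring, so it preserves sign 1. It is surjective, so some v of sign -1
has a trace of sign -1, and adding v settles the remaining case. -/
theorem asSign_trace (x : K) : asSign (Algebra.trace F K x) = asSign x := by
  have h1 : ∀ z : K, asSign z = 1 → asSign (Algebra.trace F K z) = 1 := by
    intro z hz
    obtain ⟨y, rfl⟩ := asSign_eq_one_iff.1 hz
    rw [map_add, trace_sq, asSign_artinSchreier]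
  rcases asSign_eq_one_or x with hx | hx
  · rw [hx, h1 x hx]
  · obtain ⟨c, hc⟩ := exists_asSign_eq_neg_one F
    obtain ⟨v, rfl⟩ := Algebra.trace_surjective F K c
    have hv : asSign v = -1 := by
      refine (asSign_eq_one_or v).resolve_left fun h => ?_
      rw [h1 v h] at hc; norm_num at hc
    have := h1 (x + v) (by rw [asSign_add, hx, hv]; norm_num)
    rw [map_add, asSign_add, hc] at this
    rw [hx]; linarith

theorem asSign_frob (x : K) : asSign (frob F K x) = asSign x := by
  rw [← asSign_trace F, trace_frob, asSign_trace]

end trace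

/-! ### The linearized polynomial of the radical. -/

section radicalPoly

variable {F K : Type*} [Field F] [Field K] [Algebra F K]

/-- The linearized polynomial governing the radical of the quadratic form
`x ↦ asSign (curvePoly F a b x)`. -/
def radicalPoly (a b : F) (u : K) : K :=
  algebraMap F K a ^ 2 * u ^ 4 + algebraMap F K b ^ 2 * u ^ 2 + algebraMap F K a * u

@[simp] theorem radicalPoly_zero (a b : F) : radicalPoly a b (0 : K) = 0 := by
  simp [radicalPoly]

theorem radicalPoly_add [CharP K 2] (a b : F) (u v : K) :
    radicalPoly a b (u + v) = radicalPoly a b u + radicalPoly a b v := by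
  have h4 : (u + v) ^ 4 = u ^ 4 + v ^ 4 := by
    rw [show 4 = 2 * 2 from rfl, pow_mul, CharTwo.add_sq, CharTwo.add_sq, ← pow_mul, ← pow_mul]
  simp only [radicalPoly, h4, CharTwo.add_sq]
  ring

theorem radicalPoly_algEquiv (a b : F) (g : Gal(K/F)) (u : K) :
    g (radicalPoly a b u) = radicalPoly a b (g u) := by
  simp [radicalPoly]

end radicalPoly

/-! ### The quadratic form, its polarization, and the square of its sum. -/

section curve

variable (F : Type*) {K : Type*} [Field F] [Field K] [Algebra F K] [Fintype F] [Fintype K]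

/-- The polynomial function `a * x * x' * (x + x') + b * (x * x' + x ^ 2)`, where `x' = x ^ #F`. -/
noncomputable def curvePoly (a b : F) (x : K) : K :=
  algebraMap F K a * (x * frob F K x * (x + frob F K x)) +
    algebraMap F K b * (x * frob F K x + x ^ 2)

/-- The exponential sum attached to `curvePoly`. -/
noncomputable def curveSum (K : Type*) [Field K] [Algebra F K] [Fintype K] (a b : F) : ℤ :=
  ∑ x : K, asSign (curvePoly F a b x)

theorem curvePoly_algEquiv (a b : F) (g : Gal(K/F)) (x : K) :
    g (curvePoly F a b x) = curvePoly F a b (g x) := by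
  simp [curvePoly]

variable [CharP F 2] [CharP K 2]

theorem asSign_curvePoly_frob_pow (a b : F) (x : K) (i : ℕ) :
    asSign (curvePoly F a b ((frob F K ^ i) x)) = asSign (curvePoly F a b x) := by
  induction i with
  | zero => rfl
  | succ i ih =>
    rw [pow_succ', AlgEquiv.mul_apply, ← curvePoly_algEquiv, asSign_frob, ih]

theorem asSign_curvePoly_add (a b : F) (x h : K) :
    asSign (curvePoly F a b (x + h)) = asSign (curvePoly F a b x) * asSign (curvePoly F a b h) *
      asSign (frob F K x ^ 2 * radicalPoly a b ((frob F K ^ 2) h + h)) := by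
  have h2 : (2 : K) = 0 := CharTwo.two_eq_zero
  have e : curvePoly F a b (x + h) = curvePoly F a b x + curvePoly F a b h +
      (algebraMap F K a * x ^ 2 * frob F K h + algebraMap F K a * h ^ 2 * frob F K x +
        algebraMap F K a * x * frob F K h ^ 2 + algebraMap F K a * h * frob F K x ^ 2 +
        algebraMap F K b * x * frob F K h + algebraMap F K b * h * frob F K x) := by
    simp only [curvePoly, map_add]
    linear_combination (algebraMap F K a * (x * h * frob F K x + x * h * frob F K h +
      x * frob F K x * frob F K h + h * frob F K x * frob F K h) + algebraMap F K b * x * h) * h2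
  rw [e, asSign_add, asSign_add]
  congr 1
  rw [pow_two (frob F K), AlgEquiv.mul_apply]
  simp only [radicalPoly_add]
  simp only [asSign_add]
  -- Frobenius and squaring preserve the sign, so each cross term can be moved until it carries the
  -- common factor `frob F K x ^ 2`.
  rw [← asSign_frob F (algebraMap F K a * x ^ 2 * frob F K h),
    ← asSign_sq (algebraMap F K a * h ^ 2 * frob F K x),
    ← asSign_frob F (algebraMap F K a * x * frob F K h ^ 2),
    ← asSign_sq (frob F K (algebraMap F K a * x * frob F K h ^ 2)),
    ← asSign_frob F (algebraMap F K b * x * frob F K h),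
    ← asSign_sq (frob F K (algebraMap F K b * x * frob F K h)),
    ← asSign_sq (algebraMap F K b * h * frob F K x)]
  simp only [← asSign_add, map_mul, map_pow, AlgEquiv.commutes, radicalPoly]
  congr 1
  ring

/-- Substitute y = x + h in the double sum. For fixed h the sum over x is a complete character sum,
which vanishes unless h is in the radical. -/
theorem curveSum_sq [DecidableEq K] (a b : F) :
    curveSum F K a b ^ 2 = Fintype.card K *
      ∑ h : K, if radicalPoly a b ((frob F K ^ 2) h + h) = 0 then asSign (curvePoly F a b h)
        else 0 := by
  have h1 : curveSum F K a b ^ 2 =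
      ∑ x : K, ∑ h : K, asSign (curvePoly F a b x) * asSign (curvePoly F a b (x + h)) := by
    rw [sq, curveSum, sum_mul_sum]
    refine sum_congr rfl fun x _ => ?_
    exact (Fintype.sum_bijective (x + ·) (AddGroup.addLeft_bijective x) _ _ fun _ => rfl).symm
  rw [h1, sum_comm, mul_sum]
  refine sum_congr rfl fun h _ => ?_
  have h2 : ∀ x : K, asSign (curvePoly F a b x) * asSign (curvePoly F a b (x + h)) =
      asSign (curvePoly F a b h) *
        asSign (frob F K x ^ 2 * radicalPoly a b ((frob F K ^ 2) h + h)) := by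
    intro x
    rw [asSign_curvePoly_add]
    linear_combination asSign (curvePoly F a b h) *
      asSign (frob F K x ^ 2 * radicalPoly a b ((frob F K ^ 2) h + h)) *
      asSign_mul_self (curvePoly F a b x)
  simp_rw [h2]
  rw [← mul_sum, Fintype.sum_bijective (frob F K) (frob F K).bijective _
    (fun x => asSign (x ^ 2 * radicalPoly a b ((frob F K ^ 2) h + h))) fun _ => rfl,
    sum_asSign_sq_mul_eq_ite]
  split_ifs <;> ring

theorem asSign_curvePoly_add_of_radicalPoly_eq_zero {a b : F} {h : K}
    (hh : radicalPoly a b ((frob F K ^ 2) h + h) = 0) (x : K) :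
    asSign (curvePoly F a b (x + h)) =
      asSign (curvePoly F a b x) * asSign (curvePoly F a b h) := by
  rw [asSign_curvePoly_add, hh, mul_zero, asSign_zero, mul_one]

theorem curveSum_sq_of_radical {a b : F} (h : ∀ w : K,
    radicalPoly a b ((frob F K ^ 2) w + w) = 0 → asSign (curvePoly F a b w) = 1) :
    curveSum F K a b ^ 2 = Fintype.card K *
      Nat.card {w : K // radicalPoly a b ((frob F K ^ 2) w + w) = 0} := by
  classical
  rw [curveSum_sq, Nat.card_eq_fintype_card, Fintype.card_subtype, card_filter]
  push_cast
  congr 1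
  refine sum_congr rfl fun w _ => ?_
  split_ifs with hw
  · exact h w hw
  · rfl

/-- Translation by h permutes K and negates every term. -/
theorem curveSum_eq_zero_of_radical {a b : F} {h : K}
    (hh : radicalPoly a b ((frob F K ^ 2) h + h) = 0) (hs : asSign (curvePoly F a b h) = -1) :
    curveSum F K a b = 0 := by
  have : curveSum F K a b = -curveSum F K a b := by
    conv_lhs => rw [curveSum, ← Fintype.sum_bijective (· + h) (AddGroup.addRight_bijective h)
      (fun x => asSign (curvePoly F a b (x + h))) _ fun _ => rfl]
    simp_rw [asSign_curvePoly_add_of_radicalPoly_eq_zero F hh, hs]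
    simp [curveSum]
  linarith

end curve

/-! ### Subfields fixed by powers of Frobenius; the kernel of σ² + 1. -/

section fixedField

variable (F : Type*) {K : Type*} [Field F] [Field K] [Algebra F K] [Fintype F] [Fintype K]

theorem frob_pow_gcd_fixed {x : K} {i j : ℕ} (hi : (frob F K ^ i) x = x)
    (hj : (frob F K ^ j) x = x) : (frob F K ^ i.gcd j) x = x := by
  rw [AlgEquiv.coe_pow] at *
  exact Function.IsPeriodicPt.gcd hi hj

theorem frob_pow_fixed_of_dvd {x : K} {i j : ℕ} (hi : (frob F K ^ i) x = x) (hij : i ∣ j) :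
    (frob F K ^ j) x = x := by
  rw [AlgEquiv.coe_pow] at *
  exact Function.IsPeriodicPt.trans_dvd hi hij

/-- The subfield of `K` fixed by the `d`-th power of the Frobenius over `F`. -/
noncomputable def frobFixedField (K : Type*) [Field K] [Algebra F K] [Fintype K] (d : ℕ) :
    IntermediateField F K :=
  IntermediateField.fixedField (Subgroup.zpowers (frob F K ^ d))

theorem mem_frobFixedField {d : ℕ} {x : K} :
    x ∈ frobFixedField F K d ↔ (frob F K ^ d) x = x := by
  rw [frobFixedField, IntermediateField.mem_fixedField_iff]
  constructor
  · intro h; exact h _ (Subgroup.mem_zpowers _)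
  · intro h f hf
    have h1 : Subgroup.zpowers (frob F K ^ d) ≤ MulAction.stabilizer Gal(K/F) x :=
      (Subgroup.zpowers_le).2 h
    exact h1 hf

theorem finrank_over_frobFixedField {d : ℕ} (hd : d ≠ 0) (h : d ∣ Module.finrank F K) :
    Module.finrank (frobFixedField F K d) K = Module.finrank F K / d := by
  rw [frobFixedField, IntermediateField.finrank_fixedField_eq_card, Nat.card_zpowers,
    orderOf_pow_of_dvd hd, FiniteField.orderOf_frobeniusAlgEquivOfAlgebraic]
  rwa [FiniteField.orderOf_frobeniusAlgEquivOfAlgebraic]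

theorem finrank_frobFixedField {d : ℕ} (hd : d ≠ 0) (h : d ∣ Module.finrank F K) :
    Module.finrank F (frobFixedField F K d) = d := by
  have h1 := Module.finrank_mul_finrank F (frobFixedField F K d) K
  rw [finrank_over_frobFixedField F hd h] at h1
  have h2 := Nat.mul_div_cancel' h
  have h3 : 0 < Module.finrank F K / d :=
    Nat.div_pos (Nat.le_of_dvd Module.finrank_pos h) (Nat.pos_of_ne_zero hd)
  exact Nat.eq_of_mul_eq_mul_right h3 (by rw [h1, h2])

theorem card_frob_pow_fixed {d : ℕ} (hd : d ≠ 0) (h : d ∣ Module.finrank F K) :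
    Nat.card {x : K // (frob F K ^ d) x = x} = Fintype.card F ^ d := by
  rw [← Nat.card_congr (Equiv.subtypeEquivRight fun x => mem_frobFixedField F (d := d) (x := x)),
    ← Nat.card_eq_fintype_card]
  have := Module.natCard_eq_pow_finrank (K := F) (V := frobFixedField F K d)
  rwa [finrank_frobFixedField F hd h] at this

variable [CharP K 2]

theorem card_frob_sq_add_of_even (h : Even (Module.finrank F K)) :
    Nat.card {x : K // (frob F K ^ 2) x + x = 0} = Fintype.card F ^ 2 := by
  rw [← card_frob_pow_fixed F (K := K) two_ne_zero h.two_dvd]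
  exact Nat.card_congr (Equiv.subtypeEquivRight fun x => CharTwo.add_eq_zero)

omit [CharP K 2] in
theorem frob_fixed_of_sq_fixed_of_odd (h : Odd (Module.finrank F K)) {x : K}
    (hx : (frob F K ^ 2) x = x) : frob F K x = x := by
  have h1 : (frob F K ^ Module.finrank F K) x = x := by rw [frob_pow_finrank]; rfl
  have := frob_pow_gcd_fixed F hx h1
  rwa [Nat.coprime_two_left.2 h, pow_one] at this

theorem card_frob_sq_add_of_odd (h : Odd (Module.finrank F K)) :
    Nat.card {x : K // (frob F K ^ 2) x + x = 0} = Fintype.card F := by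
  have := card_frob_pow_fixed F (K := K) one_ne_zero (one_dvd _)
  simp only [pow_one] at this
  rw [← this]
  refine Nat.card_congr (Equiv.subtypeEquivRight fun x => ?_)
  rw [CharTwo.add_eq_zero]
  refine ⟨frob_fixed_of_sq_fixed_of_odd F h, fun h => ?_⟩
  rw [pow_two, AlgEquiv.mul_apply, h, h]

end fixedField

/-! ### Congruences between sums over a field and over a subfield. -/

section congruence

/-- Outside the fixed points the orbits have p elements and s is constant on them. Splitting by the
value of s reduces this to counting fixed points on each level set. -/
theorem sum_modEq_sum_fixed {α : Type*} [Fintype α] [DecidableEq α] {p : ℕ} [Fact p.Prime]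
    (g : Equiv.Perm α) (hg : g ^ p = 1) (s : α → ℤ) (hs : ∀ x, s (g x) = s x) :
    ∑ x, s x ≡ ∑ x with g x = x, s x [ZMOD p] := by
  have h1 : ∑ x, s x = ∑ c ∈ univ.image s, (#{x | s x = c} : ℤ) * c := by
    rw [← sum_fiberwise_of_maps_to (s := univ) (t := univ.image s) (g := s)
      fun x _ => mem_image_of_mem _ (mem_univ _)]
    refine sum_congr rfl fun c _ => ?_
    rw [sum_congr rfl fun x hx => (mem_filter.1 hx).2, sum_const, nsmul_eq_mul]
  have h2 : ∑ x with g x = x, s x = ∑ c ∈ univ.image s, (#{x | s x = c ∧ g x = x} : ℤ) * c := by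
    rw [← sum_fiberwise_of_maps_to (s := univ.filter fun x => g x = x) (t := univ.image s) (g := s)
      fun x _ => mem_image_of_mem _ (mem_univ _)]
    refine sum_congr rfl fun c _ => ?_
    rw [sum_congr rfl fun x hx => (mem_filter.1 hx).2, sum_const, nsmul_eq_mul, filter_filter]
    simp_rw [and_comm]
  rw [h1, h2]
  refine Int.ModEq.sum fun c _ => Int.ModEq.mul_right _ ?_
  have hc : ∀ x, s x = c ↔ s (g x) = c := fun x => by rw [hs]
  have hf : (g.subtypePerm fun x => (hc x).symm : Equiv.Perm {x // s x = c}) ^ p ^ 1 = 1 := by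
    rw [pow_one, Equiv.Perm.subtypePerm_pow]
    ext x
    simp [hg]
  have := Equiv.Perm.card_compl_support_modEq hf
  rw [← Int.natCast_modEq_iff] at this
  convert this.symm using 2
  · rw [Fintype.card_subtype]
  · rw [← card_map (Function.Embedding.subtype _)]
    congr 1
    ext x
    simp [Subtype.ext_iff, and_comm]

variable (F : Type*) {K : Type*} [Field F] [Field K] [Algebra F K] [Fintype F] [Fintype K]
  [CharP F 2] [CharP K 2]

theorem asSign_algebraMap_of_odd (h : Odd (Module.finrank F K)) (x : F) :
    asSign (algebraMap F K x) = asSign x := by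
  rw [← asSign_trace F, Algebra.trace_algebraMap, nsmul_eq_mul, CharTwo.natCast_eq_ite,
    if_neg (by simpa using h), one_mul]

theorem asSign_algebraMap_of_even (h : Even (Module.finrank F K)) (x : F) :
    asSign (algebraMap F K x) = 1 := by
  rw [← asSign_trace F, Algebra.trace_algebraMap, nsmul_eq_mul, CharTwo.natCast_eq_ite,
    if_pos h, zero_mul, asSign_zero]

theorem curveSum_modEq {d p : ℕ} [Fact p.Prime] (hp : p ≠ 2) (hn : Module.finrank F K = d * p)
    [Fintype (frobFixedField F K d)] (a b : F) :
    curveSum F K a b ≡ curveSum F (frobFixedField F K d) a b [ZMOD p] := by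
  classical
  have hpp : p.Prime := Fact.out
  have hd : d ≠ 0 := by
    rintro rfl
    have := Module.finrank_pos (R := F) (M := K)
    omega
  have hg : ((frob F K ^ d).toEquiv : Equiv.Perm K) ^ p = 1 := by
    have h : (frob F K ^ d) ^ p = 1 := by rw [← pow_mul, ← hn, frob_pow_finrank]
    ext x
    have h' := DFunLike.congr_fun h x
    rw [AlgEquiv.coe_pow] at h'
    rw [Equiv.Perm.coe_pow]
    exact h'
  have h1 := sum_modEq_sum_fixed _ hg (fun x => asSign (curvePoly F a b x))
    fun x => asSign_curvePoly_frob_pow F a b x d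
  -- The relative degree is the odd prime p, so a sign computed in the subfield agrees with the sign
  -- in K.
  have hodd : Odd (Module.finrank (frobFixedField F K d) K) := by
    rw [finrank_over_frobFixedField F hd ⟨p, hn⟩, hn,
      Nat.mul_div_cancel_left _ (Nat.pos_of_ne_zero hd)]
    exact hpp.odd_of_ne_two hp
  have : CharP (frobFixedField F K d) 2 := charP_of_injective_algebraMap' F 2
  suffices h2 : curveSum F (frobFixedField F K d) a b =
      ∑ x : K with (frob F K ^ d).toEquiv x = x, asSign (curvePoly F a b x) by
    rw [h2]; exact h1
  rw [curveSum, ← sum_subtype_eq_sum_filter]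
  simp only [subtype_univ]
  refine Fintype.sum_equiv (Equiv.subtypeEquivRight fun x => mem_frobFixedField F) _ _ fun x => ?_
  rw [← asSign_algebraMap_of_odd (frobFixedField F K d) hodd]
  congr 1

end congruence

/-! ### Partial Frobenius sums. -/

section sums

variable (F : Type*) {K : Type*} [Field F] [Field K] [Algebra F K] [Fintype F] [Fintype K]

theorem sum_range_frob_add_frob [CharP K 2] (G : K) (h : ℕ) :
    ∑ i ∈ range h, (frob F K ^ i) (G + frob F K G) = G + (frob F K ^ h) G := by
  have h2 : (2 : K) = 0 := CharTwo.two_eq_zero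
  induction h with
  | zero => simp [CharTwo.add_self_eq_zero]
  | succ h ih =>
    rw [sum_range_succ, ih, map_add, pow_succ, AlgEquiv.mul_apply]
    linear_combination (frob F K ^ h) G * h2

theorem sum_range_mul_frob_of_fixed {R : K} {d : ℕ} (hR : (frob F K ^ d) R = R) (k : ℕ) :
    ∑ i ∈ range (d * k), (frob F K ^ i) R = k * ∑ i ∈ range d, (frob F K ^ i) R := by
  induction k with
  | zero => simp
  | succ k ih =>
    rw [mul_add, mul_one, sum_range_add, ih]
    have : ∀ i, (frob F K ^ (d * k + i)) R = (frob F K ^ i) R := by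
      intro i
      rw [add_comm, pow_add, AlgEquiv.mul_apply, frob_pow_fixed_of_dvd F hR ⟨k, rfl⟩]
    simp_rw [this]
    push_cast
    ring

theorem sum_range_two_mul_frob (v : K) (h : ℕ) :
    ∑ i ∈ range (2 * h), (frob F K ^ i) v =
      ∑ i ∈ range h, (frob F K ^ i) (v + (frob F K ^ h) v) := by
  rw [two_mul, sum_range_add, ← sum_add_distrib]
  refine sum_congr rfl fun i _ => ?_
  rw [map_add, add_comm h, pow_add, AlgEquiv.mul_apply]

theorem exists_sum_range_frob_eq (c : F) : ∃ v : K,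
    ∑ i ∈ range (Module.finrank F K), (frob F K ^ i) v = algebraMap F K c := by
  obtain ⟨v, rfl⟩ := Algebra.trace_surjective F K c
  exact ⟨v, (algebraMap_trace_eq_sum_frob F v).symm⟩

end sums

/-! ### Size of the sum when the radical is the kernel of σ² + 1, and vanishing for n ≡ 2 mod 4. -/

section magnitude

variable (F : Type*) {K : Type*} [Field F] [Field K] [Algebra F K] [Fintype F] [Fintype K]
  [CharP F 2] [CharP K 2]

omit [CharP F 2] in
theorem curvePoly_of_frob_fixed {x : K} (h : frob F K x = x) (a b : F) : curvePoly F a b x = 0 := by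
  have h2 : (2 : K) = 0 := CharTwo.two_eq_zero
  rw [curvePoly, h]
  linear_combination (algebraMap F K a * x ^ 3 + algebraMap F K b * x ^ 2) * h2

omit [CharP F 2] in
theorem curveSum_of_finrank_eq_one (h : Module.finrank F K = 1) (a b : F) :
    curveSum F K a b = Fintype.card F := by
  have h1 : ∀ x : K, frob F K x = x := by
    intro x
    have := frob_pow_finrank F (K := K)
    rw [h, pow_one] at this
    rw [this]; rfl
  simp [curveSum, curvePoly_of_frob_fixed F (h1 _), Module.card_eq_pow_finrank (K := F) (V := K), h]

/-- For odd degree the radical is F itself, where the form vanishes. -/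
theorem curveSum_sq_of_odd (h : Odd (Module.finrank F K)) {a b : F}
    (hP : ∀ u : K, radicalPoly a b u = 0 → u = 0) :
    curveSum F K a b ^ 2 = (Fintype.card F : ℤ) ^ (Module.finrank F K + 1) := by
  rw [curveSum_sq_of_radical, pow_succ (Fintype.card F : ℤ)]
  · have : ∀ w : K, radicalPoly a b ((frob F K ^ 2) w + w) = 0 ↔ (frob F K ^ 2) w + w = 0 :=
      fun w => ⟨hP _, fun h => by rw [h, radicalPoly_zero]⟩
    rw [Nat.card_congr (Equiv.subtypeEquivRight this), card_frob_sq_add_of_odd F h,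
      Module.card_eq_pow_finrank (K := F) (V := K)]
    push_cast; rfl
  · intro w hw
    have := frob_fixed_of_sq_fixed_of_odd F h (CharTwo.add_eq_zero.1 (hP _ hw))
    rw [curvePoly_of_frob_fixed F this, asSign_zero]

omit [CharP F 2] in
/-- For `c` fixed by the square of the Frobenius, `curvePoly F a b c` has trace
`(n / 2) * b * (c + c') ^ 2`. -/
theorem curvePoly_add_frob_of_sq_fixed {c : K} (h : (frob F K ^ 2) c = c) (a b : F) :
    curvePoly F a b c + frob F K (curvePoly F a b c) =
      algebraMap F K b * (c + frob F K c) ^ 2 := by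
  have h2 : (2 : K) = 0 := CharTwo.two_eq_zero
  rw [pow_two, AlgEquiv.mul_apply] at h
  rw [curvePoly_algEquiv]
  simp only [curvePoly, h]
  linear_combination (algebraMap F K a * (c * frob F K c * (c + frob F K c))) * h2

omit [CharP F 2] in
theorem trace_curvePoly_of_sq_fixed {k : ℕ} (hn : Module.finrank F K = 2 * k) {c : K}
    (h : (frob F K ^ 2) c = c) (a b : F) :
    algebraMap F K (Algebra.trace F K (curvePoly F a b c)) =
      k * (algebraMap F K b * (c + frob F K c) ^ 2) := by
  have h1 : (frob F K ^ 2) (curvePoly F a b c) = curvePoly F a b c := by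
    rw [curvePoly_algEquiv, h]
  rw [algebraMap_trace_eq_sum_frob, hn, sum_range_mul_frob_of_fixed F h1,
    ← curvePoly_add_frob_of_sq_fixed F h, sum_range_succ, sum_range_one, pow_one]
  rfl

/-- A radical element c of sign -1 exists: for c fixed by σ² the form has trace k·b·(c + c')² with k
= n/2 odd, and c + c' can be prescribed in F. -/
theorem curveSum_eq_zero_of_mod_four_eq_two (h : Module.finrank F K % 4 = 2) {a b : F}
    (hb : b ≠ 0) : curveSum F K a b = 0 := by
  obtain ⟨e, he⟩ := exists_asSign_eq_neg_one F
  obtain ⟨t, ht⟩ := (frobenius_inj F 2).bijective_of_finite.2 (e / b)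
  obtain ⟨v, hv⟩ := exists_sum_range_frob_eq F (K := K) t
  obtain ⟨k, hk⟩ : ∃ k, Module.finrank F K = 2 * k := ⟨Module.finrank F K / 2, by omega⟩
  have hk1 : Odd k := by rw [Nat.odd_iff]; omega
  -- The even conjugates of v; c' collects the odd ones, so c + c' is the trace t of v.
  set c := ∑ i ∈ range k, (frob F K ^ (2 * i)) v with hc
  have hc1 : c + frob F K c = algebraMap F K t := by
    rw [← hv, hk, hc, map_sum, ← sum_add_distrib]
    clear_value c
    clear hk hk1 hc
    induction k with
    | zero => simp
    | succ k ih =>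
      rw [sum_range_succ, ih, mul_add, mul_one, sum_range_succ, sum_range_succ, add_assoc,
        pow_succ', AlgEquiv.mul_apply]
  have hc2 : (frob F K ^ 2) c = c := by
    have := congrArg (frob F K) hc1
    rw [map_add, AlgEquiv.commutes, ← hc1, add_comm] at this
    rw [pow_two, AlgEquiv.mul_apply]
    exact add_right_cancel this
  apply curveSum_eq_zero_of_radical F (h := c)
  · rw [hc2, CharTwo.add_self_eq_zero, radicalPoly_zero]
  · have h3 := trace_curvePoly_of_sq_fixed F hk hc2 a b
    rw [hc1, CharTwo.natCast_eq_ite, if_neg (by simpa using hk1), one_mul, ← map_pow, ← map_mul]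
      at h3
    have h4 : t ^ 2 = e / b := ht
    rw [← asSign_trace F, (algebraMap F K).injective h3, h4, mul_div_cancel₀ _ hb, he]

theorem asSign_curvePoly_of_sq_fixed (h : 4 ∣ Module.finrank F K) {c : K}
    (hc : (frob F K ^ 2) c = c) (a b : F) : asSign (curvePoly F a b c) = 1 := by
  obtain ⟨k, hk⟩ := h
  have h3 := trace_curvePoly_of_sq_fixed F (k := 2 * k) (by omega) hc a b
  rw [CharTwo.natCast_eq_ite, if_pos (even_two_mul k), zero_mul, ← map_zero (algebraMap F K)] at h3
  rw [← asSign_trace F, (algebraMap F K).injective h3, asSign_zero]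

theorem curveSum_sq_of_four_dvd (h : 4 ∣ Module.finrank F K) {a b : F}
    (hP : ∀ u : K, radicalPoly a b u = 0 → u = 0) :
    curveSum F K a b ^ 2 = (Fintype.card F : ℤ) ^ (Module.finrank F K + 2) := by
  rw [curveSum_sq_of_radical, pow_add]
  · have : ∀ w : K, radicalPoly a b ((frob F K ^ 2) w + w) = 0 ↔ (frob F K ^ 2) w + w = 0 :=
      fun w => ⟨hP _, fun h => by rw [h, radicalPoly_zero]⟩
    rw [Nat.card_congr (Equiv.subtypeEquivRight this),
      card_frob_sq_add_of_even F (even_iff_two_dvd.2 (Dvd.dvd.trans (by norm_num) h)),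
      Module.card_eq_pow_finrank (K := F) (V := K)]
    push_cast; rfl
  · intro w hw
    exact asSign_curvePoly_of_sq_fixed F h (CharTwo.add_eq_zero.1 (hP _ hw)) a b

end magnitude

/-! ### Tools for the sign when 4 ∣ n: the involution τ = σ^(n/2). -/

section sign

variable (F : Type*) {K : Type*} [Field F] [Field K] [Algebra F K] [Fintype F] [Fintype K]
  [CharP F 2] [CharP K 2]

theorem asSign_of_half_frob_fixed {h : ℕ} (hn : Module.finrank F K = 2 * h) {y : K}
    (hy : (frob F K ^ h) y = y) : asSign y = 1 := by
  have hpos := Module.finrank_pos (R := F) (M := K)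
  have hh : h ≠ 0 := by omega
  have := Fintype.ofFinite (frobFixedField F K h)
  have : CharP (frobFixedField F K h) 2 := charP_of_injective_algebraMap' F 2
  refine asSign_algebraMap_of_even (frobFixedField F K h) (K := K) ?_
    ⟨y, (mem_frobFixedField F).2 hy⟩
  rw [finrank_over_frobFixedField F hh ⟨2, by omega⟩, hn, Nat.mul_div_cancel _ (by omega)]
  exact even_two

omit [CharP F 2] [CharP K 2] in
theorem half_frob_half_frob {h : ℕ} (hn : Module.finrank F K = 2 * h) (y : K) :
    (frob F K ^ h) ((frob F K ^ h) y) = y := by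
  rw [← AlgEquiv.mul_apply, ← pow_add, ← two_mul, ← hn, frob_pow_finrank]; rfl

/-- Averaging over the totally singular subspace of elements fixed by the involution. -/
theorem curveSum_eq_sum_ite [DecidableEq K] {h : ℕ} (hn : Module.finrank F K = 2 * h) (a b : F) :
    curveSum F K a b = ∑ z : K,
      if radicalPoly a b ((frob F K ^ 2) (z + (frob F K ^ h) z) + (z + (frob F K ^ h) z)) = 0 then
        asSign (curvePoly F a b z) else 0 := by
  set τ := frob F K ^ h with hτ
  have hττ : ∀ y, τ (τ y) = y := half_frob_half_frob F hn
  have hcomm : ∀ (i : ℕ) (y : K), τ ((frob F K ^ i) y) = (frob F K ^ i) (τ y) := by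
    intro i y
    rw [hτ, ← AlgEquiv.mul_apply, ← AlgEquiv.mul_apply, ← pow_add, ← pow_add, add_comm]
  have hcomm1 : ∀ (y : K), τ (frob F K y) = frob F K (τ y) := by simp [hτ]
  have hK : (Fintype.card K : ℤ) ≠ 0 := by exact_mod_cast Fintype.card_ne_zero
  apply mul_left_cancel₀ hK
  -- Each w + τw is fixed by τ, so the form has sign 1 on it. Shifting z by such elements leaves a
  -- character sum in w that kills every z outside the stated condition.
  calc (Fintype.card K : ℤ) * curveSum F K a b
      = ∑ w : K, ∑ z : K, asSign (curvePoly F a b ((w + τ w) + z)) := by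
        have : ∀ w : K, ∑ z : K, asSign (curvePoly F a b ((w + τ w) + z)) = curveSum F K a b :=
          fun w => Fintype.sum_bijective ((w + τ w) + ·) (AddGroup.addLeft_bijective _) _ _
            fun _ => rfl
        simp [this]
    _ = ∑ z : K, ∑ w : K, asSign (curvePoly F a b z) * asSign (frob F K w ^ 2 *
          radicalPoly a b ((frob F K ^ 2) (z + τ z) + (z + τ z))) := by
        rw [sum_comm]
        refine sum_congr rfl fun z _ => sum_congr rfl fun w _ => ?_
        have hy : τ (w + τ w) = w + τ w := by rw [map_add, hττ, add_comm]
        rw [asSign_curvePoly_add, asSign_of_half_frob_fixed F hn (y := curvePoly F a b (w + τ w))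
          (by rw [curvePoly_algEquiv, ← hτ, hy]), one_mul]
        congr 1
        rw [map_add, CharTwo.add_sq, add_mul, asSign_add]
        rw [show asSign (frob F K (τ w) ^ 2 * radicalPoly a b ((frob F K ^ 2) z + z)) =
          asSign (frob F K w ^ 2 * radicalPoly a b ((frob F K ^ 2) (τ z) + τ z)) by
            have hs : ∀ y : K, asSign (τ y) = asSign y := by
              intro y
              rw [← asSign_trace F, Algebra.trace_eq_of_algEquiv, asSign_trace]
            rw [← hs, map_mul, radicalPoly_algEquiv, map_pow, hcomm1, hττ, map_add, hcomm]]
        rw [← asSign_add, ← mul_add, ← radicalPoly_add, map_add]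
        congr 3
        ring
    _ = _ := by
        rw [mul_sum]
        refine sum_congr rfl fun z _ => ?_
        rw [← mul_sum, Fintype.sum_bijective (frob F K) (frob F K).bijective _
          (fun x => asSign (x ^ 2 * radicalPoly a b ((frob F K ^ 2) (z + τ z) + (z + τ z))))
          fun _ => rfl, sum_asSign_sq_mul_eq_ite]
        split_ifs <;> ring

omit [CharP F 2] in
-- Pairing each conjugate with its image under τ = σ^(2k) leaves a coboundary G + σG, whose sum
-- telescopes to G + τG, and a σ²-fixed term R, which contributes k(R + σR).
theorem trace_curvePoly_of_half {k : ℕ} (hn : Module.finrank F K = 4 * k) {z m : K}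
    (hm : (frob F K ^ (2 * k)) z = z + m) (hm2 : (frob F K ^ 2) m = m) (a b : F) :
    algebraMap F K (Algebra.trace F K (curvePoly F a b z)) =
      algebraMap F K a * (m * frob F K m * (m + frob F K m)) +
        algebraMap F K b * (m * frob F K m + k * (m + frob F K m) ^ 2) := by
  have h2 : (2 : K) = 0 := CharTwo.two_eq_zero
  have hm3 : frob F K (frob F K m) = m := by rwa [pow_two, AlgEquiv.mul_apply] at hm2
  have hm4 : (frob F K ^ (2 * k)) (frob F K m) = frob F K m := by
    refine frob_pow_fixed_of_dvd F (i := 2) ?_ ⟨k, rfl⟩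
    rw [pow_two, AlgEquiv.mul_apply, hm3]
  have hz' : (frob F K ^ (2 * k)) (frob F K z) = frob F K z + frob F K m := by
    rw [← map_add, ← hm, ← AlgEquiv.mul_apply, ← AlgEquiv.mul_apply, ← pow_succ, ← pow_succ']
  obtain ⟨m', hm'⟩ : ∃ m', frob F K m = m' := ⟨_, rfl⟩
  rw [hm'] at hm3 hm4 hz' ⊢
  set G := algebraMap F K a * (z ^ 2 * m' + z * m' ^ 2) + algebraMap F K b * (z * m') with hG
  set R := algebraMap F K a * (m ^ 2 * m' + m * m' ^ 2) + algebraMap F K b * (m * m' + m ^ 2)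
    with hR
  have hv : curvePoly F a b z + (frob F K ^ (2 * k)) (curvePoly F a b z) =
      (G + frob F K G) + R := by
    rw [hG, hR]
    simp only [curvePoly, map_add, map_mul, map_pow, AlgEquiv.commutes, hm, hz', hm3]
    generalize frob F K z = z'
    linear_combination (algebraMap F K a * (z ^ 2 * z' + z * z' ^ 2 + z * m * z' + z * m * m' +
      z * z' * m' + m * z' * m') + algebraMap F K b * (z * z' + z ^ 2 + z * m)) * h2
  have hR1 : (frob F K ^ 2) R = R := by
    rw [pow_two, AlgEquiv.mul_apply, hR]
    simp only [map_add, map_mul, map_pow, AlgEquiv.commutes, hm3, hm']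
  rw [algebraMap_trace_eq_sum_frob, hn, show 4 * k = 2 * (2 * k) by ring,
    sum_range_two_mul_frob, hv]
  simp_rw [map_add _ (G + frob F K G) R]
  rw [sum_add_distrib, sum_range_frob_add_frob, sum_range_mul_frob_of_fixed F hR1,
    sum_range_succ, sum_range_one, pow_one, pow_zero, AlgEquiv.one_apply, hG, hR]
  simp only [map_add, map_mul, map_pow, AlgEquiv.commutes, hm3, hm', hm, hm4]
  linear_combination (algebraMap F K a * (z ^ 2 * m' + z * m * m' + z * m' ^ 2 + k * (m ^ 2 * m' + m * m' ^ 2)) +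
    algebraMap F K b * (z * m')) * h2

end sign

/-! ### Evaluation for n = 4k when `radicalPoly` has no nonzero root. -/

section fourDvd

variable (F : Type*) {K : Type*} [Field F] [Field K] [Algebra F K] [Fintype F] [Fintype K]
  [CharP F 2] [CharP K 2]

/-- Only the sign is sought here, as the size is known from `curveSum_sq_of_four_dvd`. After two
averagings every surviving group of terms consists of copies of ε. -/
theorem curveSum_sign_of_four_mul {k : ℕ} (hn : Module.finrank F K = 4 * k) {a b : F} {ε : ℤ}
    (hP : ∀ u : K, radicalPoly a b u = 0 → u = 0)
    (ht : ∀ t : F, a ^ 2 * t ^ 4 + a * t + b ^ 2 * t ^ 2 + b = 0 → t = 1)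
    (hε : ∀ N : F, asSign N = -1 → asSign ((a + b) * N + b * k) = ε) :
    0 ≤ ε * curveSum F K a b := by
  classical
  have hn' : Module.finrank F K = 2 * (2 * k) := by omega
  have h2 : (2 : F) = 0 := CharTwo.two_eq_zero
  obtain ⟨v, hv⟩ := exists_sum_range_frob_eq F (K := K) 1
  rw [hn', sum_range_two_mul_frob] at hv
  simp_rw [map_add] at hv
  rw [sum_add_distrib] at hv
  set τ := frob F K ^ (2 * k) with hτ
  -- Half of the trace of v, which is 1; τ maps it to the other half.
  obtain ⟨z₁, hz₁⟩ : ∃ z₁ : K, z₁ + τ z₁ = 1 := by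
    refine ⟨∑ i ∈ range (2 * k), (frob F K ^ i) v, ?_⟩
    rw [map_one] at hv
    rw [← hv, map_sum]
    congr 1
    refine sum_congr rfl fun i _ => ?_
    rw [hτ, ← AlgEquiv.mul_apply, ← AlgEquiv.mul_apply, ← pow_add, ← pow_add, add_comm]
  set g : K → ℤ := fun z => if (frob F K ^ 2) (z + τ z) + (z + τ z) = 0 then
    asSign (curvePoly F a b z) else 0 with hg
  have hsum : curveSum F K a b = ∑ z, g z := by
    rw [curveSum_eq_sum_ite F hn']
    refine sum_congr rfl fun z _ => ?_
    rw [hg]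
    refine if_congr ⟨hP _, fun h => ?_⟩ rfl rfl
    rw [h, radicalPoly_zero]
  have hq : (0 : ℤ) < Fintype.card F := by exact_mod_cast Fintype.card_pos
  refine nonneg_of_mul_nonneg_right (a := (Fintype.card F : ℤ)) ?_ hq
  -- Second averaging: the shift by x·z₁ with x in F replaces m = z + τz by m + x.
  have havg : (Fintype.card F : ℤ) * curveSum F K a b =
      ∑ z, ∑ x : F, g (z + algebraMap F K x * z₁) := by
    rw [sum_comm]
    have : ∀ x : F, ∑ z, g (z + algebraMap F K x * z₁) = curveSum F K a b := fun x => by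
      rw [hsum]
      exact Fintype.sum_bijective (· + algebraMap F K x * z₁) (AddGroup.addRight_bijective _) _ _
        fun _ => rfl
    simp [this]
  rw [mul_left_comm, havg, mul_sum]
  refine sum_nonneg fun z _ => ?_
  have hshift : ∀ x : F, z + algebraMap F K x * z₁ + τ (z + algebraMap F K x * z₁) =
      (z + τ z) + algebraMap F K x := by
    intro x
    rw [map_add, map_mul, AlgEquiv.commutes]
    linear_combination algebraMap F K x * hz₁
  obtain ⟨m, hm⟩ : ∃ m, z + τ z = m := ⟨_, rfl⟩
  rw [hm] at hshift
  by_cases hm2 : (frob F K ^ 2) m + m = 0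
  swap
  · have : ∀ x : F, g (z + algebraMap F K x * z₁) = 0 := by
      intro x
      rw [hg]
      simp only [hshift]
      rw [if_neg]
      rw [map_add, AlgEquiv.commutes]
      intro h
      apply hm2
      rw [← h]
      linear_combination -algebraMap F K x * (CharTwo.two_eq_zero : (2 : K) = 0)
    simp [this]
  have hm2' : (frob F K ^ 2) m = m := CharTwo.add_eq_zero.1 hm2
  have hm3 : frob F K (frob F K m) = m := by rwa [pow_two, AlgEquiv.mul_apply] at hm2'
  obtain ⟨t, ht'⟩ := (frob_fixed_iff F (x := m + frob F K m)).1 (by rw [map_add, hm3, add_comm])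
  obtain ⟨N, hN⟩ := (frob_fixed_iff F (x := m * frob F K m)).1 (by rw [map_mul, hm3, mul_comm])
  have hgx : ∀ x : F, g (z + algebraMap F K x * z₁) =
      asSign (a * ((N + x * t + x ^ 2) * t) + b * ((N + x * t + x ^ 2) + k * t ^ 2)) := by
    intro x
    rw [hg]
    simp only [hshift]
    have hmx : (frob F K ^ 2) (m + algebraMap F K x) = m + algebraMap F K x := by
      rw [map_add, AlgEquiv.commutes, hm2']
    rw [if_pos (by rw [hmx, CharTwo.add_self_eq_zero]), ← asSign_trace F]
    congr 1
    apply (algebraMap F K).injective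
    have h3 : (frob F K ^ (2 * k)) (z + algebraMap F K x * z₁) =
        (z + algebraMap F K x * z₁) + (m + algebraMap F K x) := by
      linear_combination hshift x -
        (z + algebraMap F K x * z₁) * (CharTwo.two_eq_zero : (2 : K) = 0)
    rw [trace_curvePoly_of_half F hn h3 hmx]
    simp only [map_add, AlgEquiv.commutes, map_mul, map_pow, map_natCast, ht', hN]
    linear_combination (algebraMap F K a * ((m + algebraMap F K x) * (frob F K m + algebraMap F K x) * algebraMap F K x) +
      k * algebraMap F K b * (2 * (m + frob F K m) * algebraMap F K x + 2 * algebraMap F K x ^ 2)) *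
      (CharTwo.two_eq_zero : (2 : K) = 0)
  simp_rw [hgx]
  by_cases ht1 : t = 1
  · subst ht1
    -- Here m + m' = 1, so m is a root of X² + X + N outside F, and the other root m + 1 is outside
    -- F too.
    have hNs : asSign N = -1 := by
      rw [asSign_eq_neg_one_iff]
      rintro ⟨y, rfl⟩
      rw [map_one] at ht'
      have h3 : (algebraMap F K y) ^ 2 + algebraMap F K y = m ^ 2 + m := by
        rw [← map_pow, ← map_add, hN, show frob F K m = m + 1 from ?_]
        · ring
        · rw [ht']; linear_combination -m * (CharTwo.two_eq_zero : (2 : K) = 0)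
      have h4 : frob F K m = m := by
        rw [frob_fixed_iff]
        rcases artinSchreier_eq_iff.1 h3.symm with h | h
        · exact ⟨y, h.symm⟩
        · exact ⟨y + 1, by rw [h, map_add, map_one]⟩
      rw [h4, CharTwo.add_self_eq_zero] at ht'
      exact one_ne_zero ht'
    have h3 : ∀ x : F, asSign (a * ((N + x * 1 + x ^ 2) * 1) +
        b * ((N + x * 1 + x ^ 2) + k * 1 ^ 2)) = ε := by
      intro x
      rw [← hε (N + (x ^ 2 + x)) (by rw [asSign_add, hNs, asSign_artinSchreier, mul_one])]
      congr 1
      ring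
    simp_rw [h3]
    rw [sum_const, nsmul_eq_mul, card_univ, mul_left_comm]
    exact mul_nonneg hq.le (mul_self_nonneg ε)
  -- Up to a constant sign this is an additive character of x² whose coefficient is the quartic in
  -- `ht`. It is nonzero for t ≠ 1, so the sum over x vanishes.
  · have h3 : ∀ x : F, asSign (a * ((N + x * t + x ^ 2) * t) +
        b * ((N + x * t + x ^ 2) + k * t ^ 2)) = asSign (a * N * t + b * (N + k * t ^ 2)) *
          asSign (x ^ 2 * (a ^ 2 * t ^ 4 + a * t + b ^ 2 * t ^ 2 + b)) := by
      intro x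
      rw [show a * ((N + x * t + x ^ 2) * t) + b * ((N + x * t + x ^ 2) + k * t ^ 2) =
        (a * N * t + b * (N + k * t ^ 2)) + (a * x * t ^ 2 + b * x * t + (a * x ^ 2 * t + b * x ^ 2))
        by ring, asSign_add]
      congr 1
      rw [asSign_add, asSign_add, ← asSign_sq (a * x * t ^ 2), ← asSign_sq (b * x * t),
        ← asSign_add, ← asSign_add]
      congr 1
      ring
    simp_rw [h3]
    rw [← mul_sum, sum_asSign_sq_mul_eq_ite, if_neg fun h => ht1 (ht t h)]
    simp

theorem curveSum_of_four_mul {k : ℕ} (hn : Module.finrank F K = 4 * k) {a b : F} {ε : ℤ}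
    (hP : ∀ u : K, radicalPoly a b u = 0 → u = 0)
    (ht : ∀ t : F, a ^ 2 * t ^ 4 + a * t + b ^ 2 * t ^ 2 + b = 0 → t = 1)
    (hε : ∀ N : F, asSign N = -1 → asSign ((a + b) * N + b * k) = ε) :
    curveSum F K a b = ε * (Fintype.card F : ℤ) ^ (2 * k + 1) := by
  have h1 := curveSum_sign_of_four_mul F hn hP ht hε
  have h2 := curveSum_sq_of_four_dvd F (K := K) ⟨k, hn⟩ hP
  obtain ⟨N, hN⟩ := exists_asSign_eq_neg_one F
  have h3 : ε = 1 ∨ ε = -1 := hε N hN ▸ asSign_eq_one_or _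
  have h4 : (0 : ℤ) < (Fintype.card F : ℤ) ^ (2 * k + 1) :=
    pow_pos (by exact_mod_cast Fintype.card_pos) _
  rw [hn, show 4 * k + 2 = (2 * k + 1) * 2 by ring, pow_mul, sq_eq_sq_iff_eq_or_eq_neg] at h2
  rcases h2 with h2 | h2 <;> rcases h3 with rfl | rfl <;> rw [h2] at h1 ⊢ <;> linarith

/-- The sum for the form `x * x' + x ^ 2`. -/
theorem curveSum_zero_one_of_four_mul {k : ℕ} (hn : Module.finrank F K = 4 * k) :
    curveSum F K 0 1 = -asSign (k : F) * (Fintype.card F : ℤ) ^ (2 * k + 1) := by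
  refine curveSum_of_four_mul F hn (fun u hu => ?_) (fun t ht => ?_) fun N hN => ?_
  · simpa [radicalPoly] using hu
  · have : t ^ 2 + 1 = 0 := by linear_combination ht
    have h2 : (t + 1) ^ 2 = 0 := by rw [CharTwo.add_sq, one_pow, this]
    exact CharTwo.add_eq_zero.1 (pow_eq_zero_iff two_ne_zero |>.1 h2)
  · rw [zero_add, one_mul, one_mul, asSign_add, hN, neg_one_mul]

/-- The sum for the curve when the radical is as small as possible. -/
theorem curveSum_self_of_four_mul {k : ℕ} (hn : Module.finrank F K = 4 * k) {a : F}
    (hP : ∀ u : K, radicalPoly a a u = 0 → u = 0) :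
    curveSum F K a a = asSign (a * k) * (Fintype.card F : ℤ) ^ (2 * k + 1) := by
  refine curveSum_of_four_mul F hn hP (fun t ht => ?_) fun N hN => ?_
  · have h2 : (2 : F) = 0 := CharTwo.two_eq_zero
    have : algebraMap F K (t + 1) = 0 := by
      apply hP
      rw [radicalPoly]
      simp only [← map_pow, ← map_mul, ← map_add]
      rw [map_eq_zero, ← ht]
      linear_combination (2 * a ^ 2 * t ^ 3 + 3 * a ^ 2 * t ^ 2 + 2 * a ^ 2 * t + a ^ 2 +
        a ^ 2 * t) * h2
    rw [map_eq_zero] at this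
    exact CharTwo.add_eq_zero.1 this
  · rw [CharTwo.add_self_eq_zero, zero_mul, zero_add]

end fourDvd

/-! ### The cubic has a root in F: reduction to the form zz' + z². -/

section factor

variable (F : Type*) {K : Type*} [Field F] [Field K] [Algebra F K] [Fintype F] [Fintype K]
  [CharP F 2] [CharP K 2]

omit [CharP F 2] in
-- Expanding the right side gives the left one, except that two terms appear squared, which does not
-- affect the sign.
theorem asSign_curvePoly_self_eq {a A B : F} (h1 : A * B = a) (h2 : A + B ^ 2 = a) (x : K) :
    asSign (curvePoly F a a x) =
      asSign (curvePoly F 0 1 (algebraMap F K A * x ^ 2 + algebraMap F K B * x)) := by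
  have e1 : curvePoly F a a x = algebraMap F K (A * B) * (x * frob F K x * (x + frob F K x)) +
      algebraMap F K (B ^ 2) * (x * frob F K x + x ^ 2) +
      (algebraMap F K A * (x * frob F K x) + algebraMap F K A * x ^ 2) := by
    rw [curvePoly, h1]
    nth_rewrite 2 [← h2]
    rw [map_add]
    ring
  have e2 : curvePoly F 0 1 (algebraMap F K A * x ^ 2 + algebraMap F K B * x) =
      algebraMap F K (A * B) * (x * frob F K x * (x + frob F K x)) +
      algebraMap F K (B ^ 2) * (x * frob F K x + x ^ 2) +
      ((algebraMap F K A * (x * frob F K x)) ^ 2 + (algebraMap F K A * x ^ 2) ^ 2) := by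
    simp only [curvePoly, map_add, map_mul, map_pow, AlgEquiv.commutes, map_zero, map_one,
      CharTwo.add_sq]
    ring
  rw [e1, e2]
  simp only [asSign_add, asSign_sq]

/-- Scaling x by B/A turns Ax² + Bx = z into the Artin–Schreier equation with constant Az/B², so 1 +
`asSign` counts the preimages of z. The proof detects them by orthogonality of characters. -/
theorem sum_comp_linearized (s : K → ℤ) {A B : K} (hA : A ≠ 0) (hB : B ≠ 0) :
    ∑ x, s (A * x ^ 2 + B * x) = ∑ z, s z * (1 + asSign (A / B ^ 2 * z)) := by
  classical
  have hK : (Fintype.card K : ℤ) ≠ 0 := by exact_mod_cast Fintype.card_ne_zero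
  apply mul_left_cancel₀ hK
  have h1 : ∀ x, (Fintype.card K : ℤ) * s (A * x ^ 2 + B * x) =
      ∑ z, s z * ∑ y, asSign (y * (z + (A * x ^ 2 + B * x))) := by
    intro x
    simp_rw [sum_asSign_mul_eq_ite, CharTwo.add_eq_zero]
    simp [mul_comm]
  have h2 : ∀ x y z : K, asSign (y * (z + (A * x ^ 2 + B * x))) =
      asSign (y * z) * asSign (x ^ 2 * (A * y + B ^ 2 * y ^ 2)) := by
    intro x y z
    rw [show y * (z + (A * x ^ 2 + B * x)) = y * z + (x ^ 2 * (A * y) + B * x * y) by ring,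
      asSign_add, asSign_add, ← asSign_sq (B * x * y), ← asSign_add]
    congr 2
    ring
  have h3 : ∀ y : K, A * y + B ^ 2 * y ^ 2 = 0 ↔ y = 0 ∨ y = A / B ^ 2 := by
    intro y
    rw [show A * y + B ^ 2 * y ^ 2 = y * (B ^ 2 * y + A) by ring, mul_eq_zero, CharTwo.add_eq_zero,
      eq_div_iff (pow_ne_zero 2 hB), mul_comm (B ^ 2)]
  have h4 : ∀ z : K, ∑ x, ∑ y, asSign (y * (z + (A * x ^ 2 + B * x))) =
      Fintype.card K * (1 + asSign (A / B ^ 2 * z)) := by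
    intro z
    rw [sum_comm]
    simp_rw [h2, ← mul_sum, sum_asSign_sq_mul_eq_ite, h3]
    have hne : (0 : K) ≠ A / B ^ 2 := (div_ne_zero hA (pow_ne_zero 2 hB)).symm
    simp_rw [mul_ite, mul_zero]
    rw [← sum_filter]
    have : (univ.filter fun y : K => y = 0 ∨ y = A / B ^ 2) = {0, A / B ^ 2} := by
      ext y; simp
    rw [this, sum_pair hne, zero_mul, asSign_zero]
    ring
  rw [mul_sum, sum_congr rfl fun x _ => h1 x, sum_comm, mul_sum]
  refine sum_congr rfl fun z _ => ?_
  rw [← mul_sum, h4]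
  ring

omit [Fintype F] in
theorem cubic_root_ne {α u : F} (hα : α ≠ 0) (hu : u ^ 3 + u + α⁻¹ = 0) : u ≠ 0 ∧ u + 1 ≠ 0 := by
  have h2 : (2 : F) = 0 := CharTwo.two_eq_zero
  refine ⟨?_, fun h => ?_⟩
  · rintro rfl
    simp [hα] at hu
  · rw [CharTwo.add_eq_zero.1 h] at hu
    apply inv_ne_zero hα
    linear_combination hu - h2

theorem curveSum_self_of_root {α u : F} (hα : α ≠ 0) (hu : u ^ 3 + u + α⁻¹ = 0) :
    curveSum F K α α = ∑ z : K, asSign (curvePoly F 0 1 z) *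
      (1 + asSign (algebraMap F K ((u + 1) / u) * z)) := by
  have h2 : (2 : F) = 0 := CharTwo.two_eq_zero
  obtain ⟨h0, h1⟩ := cubic_root_ne F hα hu
  have hα' : α = (u * (u + 1) ^ 2)⁻¹ := by
    rw [← inv_inv α]
    congr 1
    linear_combination hu - (u ^ 3 + u ^ 2 + u) * h2
  -- Since α = 1/(u(u + 1)²), these A and B satisfy AB = A + B² = α.
  set A := (u * (u + 1))⁻¹ with hA
  set B := (u + 1)⁻¹ with hB
  have hAB : A * B = α := by rw [hA, hB, hα']; field_simp
  have hAB2 : A + B ^ 2 = α := by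
    rw [hA, hB, hα']
    field_simp
    linear_combination u * h2
  have hA0 : algebraMap F K A ≠ 0 := by
    rw [map_ne_zero]; exact inv_ne_zero (mul_ne_zero h0 h1)
  have hB0 : algebraMap F K B ≠ 0 := by rw [map_ne_zero]; exact inv_ne_zero h1
  have he : algebraMap F K ((u + 1) / u) = algebraMap F K A / algebraMap F K B ^ 2 := by
    rw [← map_pow, ← map_div₀]
    congr 1
    rw [hA, hB]
    field_simp
  rw [he, ← sum_comp_linearized (fun z => asSign (curvePoly F 0 1 z)) hA0 hB0, curveSum]
  exact sum_congr rfl fun x _ => asSign_curvePoly_self_eq F hAB hAB2 x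

/-- Translation by a suitable w in F preserves the sign of the form, since F is radical and the form
vanishes on it, but flips the linear character. -/
theorem twistedSum_of_odd (h : Odd (Module.finrank F K)) {e : F} (he : e ≠ 0) :
    ∑ z : K, asSign (curvePoly F 0 1 z) * asSign (algebraMap F K e * z) = 0 := by
  obtain ⟨c, hc⟩ := exists_asSign_eq_neg_one F
  set w := algebraMap F K (c / e) with hw
  have hw1 : frob F K w = w := by rw [hw, AlgEquiv.commutes]
  have hw2 : (frob F K ^ 2) w = w := by rw [hw, AlgEquiv.commutes]
  have key : ∀ z : K, asSign (curvePoly F 0 1 (z + w)) * asSign (algebraMap F K e * (z + w)) =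
      -(asSign (curvePoly F 0 1 z) * asSign (algebraMap F K e * z)) := by
    intro z
    rw [asSign_curvePoly_add_of_radicalPoly_eq_zero F
      (by rw [hw2, CharTwo.add_self_eq_zero, radicalPoly_zero]), curvePoly_of_frob_fixed F hw1,
      mul_add, asSign_add, hw, ← map_mul, mul_div_cancel₀ _ he, asSign_algebraMap_of_odd F h, hc,
      asSign_zero]
    ring
  have h1 := Fintype.sum_bijective (· + w) (AddGroup.addRight_bijective w)
    (fun z => asSign (curvePoly F 0 1 (z + w)) * asSign (algebraMap F K e * (z + w)))
    (fun z => asSign (curvePoly F 0 1 z) * asSign (algebraMap F K e * z)) fun _ => rfl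
  simp_rw [key] at h1
  rw [sum_neg_distrib] at h1
  linarith

/-- Completing the square: if σ²w + w = e, the linear character is the polar form paired with w, so
translation by w removes it at the cost of the sign of the form at w. -/
theorem twistedSum_of_four_mul {k : ℕ} (hn : Module.finrank F K = 4 * k) (e : F) :
    ∑ z : K, asSign (curvePoly F 0 1 z) * asSign (algebraMap F K e * z) =
      asSign (k * e) * curveSum F K 0 1 := by
  have h2 : (2 : K) = 0 := CharTwo.two_eq_zero
  obtain ⟨v, hv⟩ := exists_sum_range_frob_eq F (K := K) 1
  -- In each block of four conjugates of v, y takes the first two and σ²y the last two, so together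
  -- they give the trace 1.
  set y := ∑ i ∈ range k, (frob F K ^ (4 * i)) (v + frob F K v) with hy
  have hy1 : y + (frob F K ^ 2) y = 1 := by
    rw [← map_one (algebraMap F K), ← hv, hn, hy, map_sum, ← sum_add_distrib]
    clear_value y
    clear hn hv hy
    induction k with
    | zero => simp
    | succ k ih =>
      rw [sum_range_succ, ih, mul_add, mul_one]
      iterate 4 rw [sum_range_succ]
      have : ∀ i j, (frob F K ^ i) ((frob F K ^ j) v) = (frob F K ^ (j + i)) v := by
        intro i j
        rw [← AlgEquiv.mul_apply, ← pow_add, add_comm]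
      have h1 : frob F K v = (frob F K ^ 1) v := by rw [pow_one]
      rw [h1, map_add, map_add, this, this, this, add_comm 1 (4 * k),
        show 4 * k + 1 + 2 = 4 * k + 3 from rfl]
      ring
  set w := algebraMap F K e * y with hw
  have hw2 : (frob F K ^ 2) w = w + algebraMap F K e := by
    rw [hw, map_mul, AlgEquiv.commutes]
    linear_combination algebraMap F K e * hy1 - algebraMap F K e * y * h2
  have hw2' : frob F K (frob F K w) = w + algebraMap F K e := by
    rwa [pow_two, AlgEquiv.mul_apply] at hw2
  have hw4 : (frob F K ^ 4) w = w := by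
    rw [show 4 = 2 + 2 from rfl, pow_add, AlgEquiv.mul_apply, hw2, map_add, hw2, AlgEquiv.commutes]
    linear_combination algebraMap F K e * h2
  have hcw : asSign (curvePoly F 0 1 w) = asSign (k * e) := by
    have h3 : (frob F K ^ 4) (curvePoly F 0 1 w) = curvePoly F 0 1 w := by
      rw [curvePoly_algEquiv, hw4]
    have h4 : ∑ i ∈ range 4, (frob F K ^ i) (curvePoly F 0 1 w) = algebraMap F K e ^ 2 := by
      simp only [curvePoly_algEquiv]
      iterate 4 rw [sum_range_succ]
      rw [sum_range_zero, pow_succ (frob F K) 2, pow_two]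
      simp only [pow_one, pow_zero, AlgEquiv.mul_apply, AlgEquiv.one_apply, curvePoly, hw2',
        map_add, AlgEquiv.commutes, map_zero, map_one]
      generalize frob F K w = w'
      linear_combination (2 * w * w' + w ^ 2 + w' ^ 2 + w * algebraMap F K e +
        2 * w' * algebraMap F K e + w * algebraMap F K e + w' * algebraMap F K e +
        2 * algebraMap F K e ^ 2) * h2
    have h5 : Algebra.trace F K (curvePoly F 0 1 w) = k * e ^ 2 := by
      apply (algebraMap F K).injective
      rw [algebraMap_trace_eq_sum_frob, hn, sum_range_mul_frob_of_fixed F h3, h4]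
      simp
    rw [← asSign_trace F, h5, ← asSign_sq (k * e), mul_pow, CharTwo.natCast_eq_ite]
    congr 2
    split_ifs <;> simp
  have key : ∀ z : K, asSign (curvePoly F 0 1 z) * asSign (algebraMap F K e * z) =
      asSign (k * e) * asSign (curvePoly F 0 1 (z + w)) := by
    intro z
    rw [asSign_curvePoly_add, hw2, hcw]
    have : radicalPoly (0 : F) 1 (w + algebraMap F K e + w) = algebraMap F K e ^ 2 := by
      rw [radicalPoly, map_zero, map_one]
      linear_combination (2 * w ^ 2 + 2 * w * algebraMap F K e) * h2
    rw [this, ← mul_pow, asSign_sq, ← asSign_frob F (algebraMap F K e * z), map_mul,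
      AlgEquiv.commutes, mul_comm (frob F K z)]
    linear_combination -asSign (curvePoly F 0 1 z) * asSign (algebraMap F K e * frob F K z) *
      asSign_mul_self ((k : F) * e)
  simp_rw [key]
  rw [← mul_sum, curveSum]
  congr 1
  exact Fintype.sum_bijective (· + w) (AddGroup.addRight_bijective w) _ _ fun _ => rfl

theorem curveSum_self_of_root_of_odd {α u : F} (hα : α ≠ 0) (hu : u ^ 3 + u + α⁻¹ = 0)
    (h : Odd (Module.finrank F K)) : curveSum F K α α = curveSum F K 0 1 := by
  obtain ⟨h0, h1⟩ := cubic_root_ne F hα hu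
  rw [curveSum_self_of_root F hα hu]
  simp_rw [mul_add, mul_one]
  rw [sum_add_distrib, twistedSum_of_odd F h (div_ne_zero h1 h0), add_zero, curveSum]

theorem curveSum_self_of_root_of_four_mul {α u : F} (hα : α ≠ 0) (hu : u ^ 3 + u + α⁻¹ = 0)
    {k : ℕ} (hn : Module.finrank F K = 4 * k) :
    curveSum F K α α = -(1 + asSign (k * ((u + 1) / u))) * asSign (k : F) *
      (Fintype.card F : ℤ) ^ (2 * k + 1) := by
  rw [curveSum_self_of_root F hα hu]
  simp_rw [mul_add, mul_one]
  rw [sum_add_distrib, twistedSum_of_four_mul F hn, ← curveSum,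
    curveSum_zero_one_of_four_mul F hn]
  ring

end factor

/-! ### The cubic has no root in F. -/

section noRoot

variable (F : Type*) {K : Type*} [Field F] [Field K] [Algebra F K] [Fintype F] [Fintype K]
  [CharP F 2] [CharP K 2]

omit [Fintype F] [Fintype K] [CharP F 2] [CharP K 2] in
theorem radicalPoly_self_eq_zero_iff {α : F} (hα : α ≠ 0) {u : K} :
    radicalPoly α α u = 0 ↔ u = 0 ∨ u ^ 3 + u + algebraMap F K α⁻¹ = 0 := by
  have hα' : algebraMap F K α ≠ 0 := by rwa [map_ne_zero]
  rw [show radicalPoly α α u = algebraMap F K α ^ 2 * u * (u ^ 3 + u + algebraMap F K α⁻¹) by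
    rw [radicalPoly, map_inv₀]; field_simp, mul_eq_zero, mul_eq_zero]
  simp [hα]

variable {α : F} (hα : α ≠ 0) (hno : ∀ x : F, x ^ 3 + x + α⁻¹ ≠ 0)

include hα hno

omit [CharP F 2] [CharP K 2] hα in
theorem frob_root_ne {u : K} (hu : u ^ 3 + u + algebraMap F K α⁻¹ = 0) : frob F K u ≠ u := by
  intro h
  obtain ⟨c, rfl⟩ := (frob_fixed_iff F).1 h
  apply hno c
  apply (algebraMap F K).injective
  rw [map_zero, ← hu]
  simp

omit [CharP F 2] hα in
theorem root_frob_relation {u : K} (hu : u ^ 3 + u + algebraMap F K α⁻¹ = 0) :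
    u ^ 2 + u * frob F K u + frob F K u ^ 2 + 1 = 0 := by
  have h2 : (2 : K) = 0 := CharTwo.two_eq_zero
  have hv : frob F K u ^ 3 + frob F K u + algebraMap F K α⁻¹ = 0 := by
    have := congrArg (frob F K) hu
    simpa only [map_add, map_pow, AlgEquiv.commutes, map_zero] using this
  have h1 : (u + frob F K u) * (u ^ 2 + u * frob F K u + frob F K u ^ 2 + 1) = 0 := by
    linear_combination hu + hv + (u ^ 2 * frob F K u + u * frob F K u ^ 2 - algebraMap F K α⁻¹) * h2
  refine (mul_eq_zero.1 h1).resolve_left fun h => ?_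
  exact frob_root_ne F hno hu (CharTwo.add_eq_zero.1 h).symm

omit [CharP F 2] hα in
theorem frob_frob_root {u : K} (hu : u ^ 3 + u + algebraMap F K α⁻¹ = 0) :
    frob F K (frob F K u) = u + frob F K u := by
  have h2 : (2 : K) = 0 := CharTwo.two_eq_zero
  have h1 := root_frob_relation F hno hu
  have h3 := congrArg (frob F K) h1
  simp only [map_add, map_mul, map_pow, map_one, map_zero] at h3
  have h4 : (u + frob F K (frob F K u)) * (u + frob F K u + frob F K (frob F K u)) = 0 := by
    linear_combination h1 + h3 + (u * frob F K (frob F K u) - frob F K u ^ 2 - 1) * h2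
  rcases mul_eq_zero.1 h4 with h | h
  · exfalso
    have h5 : frob F K (frob F K u) = u := (CharTwo.add_eq_zero.1 h).symm
    -- If σ²u = u, the third root u + σu is fixed by σ and hence lies in F.
    apply frob_root_ne F hno (K := K) (u := u + frob F K u)
    · linear_combination frob F K u * h1 + hu + (u * frob F K u ^ 2 + u ^ 2 * frob F K u) * h2
    · rw [map_add, h5, add_comm]
  · exact (CharTwo.add_eq_zero.1 h).symm

omit [CharP F 2] hno in
theorem frob_frob_of_radicalPoly_eq_zero (hno : ∀ x : F, x ^ 3 + x + α⁻¹ ≠ 0) {u : K}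
    (hu : radicalPoly α α u = 0) : frob F K (frob F K u) = u + frob F K u := by
  rcases (radicalPoly_self_eq_zero_iff F hα).1 hu with rfl | hu
  · simp
  · exact frob_frob_root F hno hu

omit [CharP F 2] in
-- σ permutes the three roots cyclically, so σ³ fixes them; when 3 ∤ n, σ would fix them as well.
theorem radicalPoly_self_injective (h3 : ¬ 3 ∣ Module.finrank F K) {u : K}
    (hu : radicalPoly α α u = 0) : u = 0 := by
  refine ((radicalPoly_self_eq_zero_iff F hα).1 hu).resolve_right fun h => ?_
  have h2 : (2 : K) = 0 := CharTwo.two_eq_zero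
  have h4 := frob_frob_root F hno h
  have h5 : (frob F K ^ 3) u = u := by
    rw [pow_succ, pow_two, AlgEquiv.mul_apply, AlgEquiv.mul_apply, h4, map_add, h4]
    linear_combination frob F K u * h2
  have h6 : (frob F K ^ Module.finrank F K) u = u := by rw [frob_pow_finrank]; rfl
  have h7 := frob_pow_gcd_fixed F h5 h6
  rw [(Nat.Prime.coprime_iff_not_dvd Nat.prime_three).2 h3, pow_one] at h7
  exact frob_root_ne F hno h h7

omit [Fintype F] [CharP F 2] [CharP K 2] hα in
theorem exists_root_of_three_dvd (h3 : 3 ∣ Module.finrank F K) :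
    ∃ u : K, u ^ 3 + u + algebraMap F K α⁻¹ = 0 := by
  open Polynomial in
  set p : F[X] := X ^ 3 + X + C α⁻¹ with hp
  have hdeg : p.natDegree = 3 := by rw [hp]; compute_degree!
  have hirr : Irreducible p := by
    refine irreducible_of_degree_le_three_of_not_isRoot (by simp [hdeg]) fun x hx => hno x ?_
    simpa [hp, IsRoot] using hx
  have : Fact (Irreducible p) := ⟨hirr⟩
  have hfin : Module.finrank F (AdjoinRoot p) = 3 := by
    rw [← hdeg]; exact finrank_quotient_span_eq_natDegree
  obtain ⟨f⟩ := FiniteField.nonempty_algHom_of_finrank_dvd (F := F) (K := AdjoinRoot p) (L := K)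
    (hfin ▸ h3)
  refine ⟨f (AdjoinRoot.root p), ?_⟩
  have h := AdjoinRoot.eval₂_root p
  simp only [hp, eval₂_add, eval₂_pow, eval₂_X, eval₂_C] at h
  have h' := congrArg f h
  simp only [map_add, map_pow, map_zero] at h'
  rw [← h']
  congr 1
  exact (f.commutes _).symm

omit [CharP F 2] in
theorem card_radicalPoly_self_roots (h3 : 3 ∣ Module.finrank F K) :
    Nat.card {u : K // radicalPoly α α u = 0} = 4 := by
  classical
  have h2 : (2 : K) = 0 := CharTwo.two_eq_zero
  obtain ⟨u, hu⟩ := exists_root_of_three_dvd F hno h3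
  have h1 := root_frob_relation F hno hu
  have hne := frob_root_ne F hno hu
  have hu0 : u ≠ 0 := by
    rintro rfl
    simp [hα] at hu
  have hv0 : frob F K u ≠ 0 := by simpa using hu0
  have huv : u + frob F K u ≠ 0 := fun h => hne (CharTwo.add_eq_zero.1 h).symm
  have key : ∀ x : K, radicalPoly α α x = 0 ↔
      x ∈ ({0, u, frob F K u, u + frob F K u} : Finset K) := by
    intro x
    rw [radicalPoly_self_eq_zero_iff F hα,
      show x ^ 3 + x + algebraMap F K α⁻¹ = (x + u) * (x + frob F K u) * (x + (u + frob F K u)) by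
        linear_combination hu - (x + u) * h1 + (x - u * x * frob F K u - x ^ 2 * frob F K u -
          u * x ^ 2) * h2]
    simp only [mul_eq_zero, CharTwo.add_eq_zero, mem_insert, mem_singleton]
    tauto
  generalize frob F K u = v at *
  rw [Nat.card_congr (Equiv.subtypeEquivRight key), Nat.card_eq_fintype_card, Fintype.card_coe,
    card_insert_of_notMem, card_insert_of_notMem, card_pair]
  · simpa using hu0
  · simp [hne.symm, hv0]
  · simp [hu0.symm, hv0.symm, huv.symm]

omit [CharP F 2] in
-- On roots of P one has σ²u + u = σu and σ³u = u. Hence σ² + 1 is bijective there with inverse σ²,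
-- and the radical is the direct sum of ker(σ² + 1) and the roots of P.
theorem card_radical_self :
    Nat.card {w : K // radicalPoly α α ((frob F K ^ 2) w + w) = 0} =
      Nat.card {w : K // (frob F K ^ 2) w + w = 0} * Nat.card {u : K // radicalPoly α α u = 0} := by
  have h2 : (2 : K) = 0 := CharTwo.two_eq_zero
  have hU : ∀ u : K, radicalPoly α α u = 0 → frob F K (frob F K u) = u + frob F K u :=
    fun u => frob_frob_of_radicalPoly_eq_zero F hα hno
  have hUσ : ∀ u : K, radicalPoly α α u = 0 → radicalPoly α α (frob F K u) = 0 := by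
    intro u hu
    rw [← radicalPoly_algEquiv, hu, map_zero]
  rw [← Nat.card_prod]
  simp only [pow_two, AlgEquiv.mul_apply]
  refine Nat.card_congr
    { toFun := fun w => (⟨w.1 + frob F K (frob F K (frob F K (frob F K w.1) + w.1)), ?_⟩,
        ⟨frob F K (frob F K (frob F K (frob F K w.1) + w.1)), hUσ _ (hUσ _ w.2)⟩)
      invFun := fun x => ⟨x.1.1 + x.2.1, ?_⟩
      left_inv := fun w => ?_
      right_inv := fun x => ?_ }
  · have h := hU _ w.2
    obtain ⟨d, hd⟩ : ∃ d, frob F K (frob F K w.1) + w.1 = d := ⟨_, rfl⟩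
    have hw : frob F K (frob F K w.1) = w.1 + d := by linear_combination hd - w.1 * h2
    rw [hd] at h ⊢
    simp only [map_add, hw, h]
    linear_combination (w.1 + 2 * d + 2 * frob F K d) * h2
  · have h := hU _ x.2.2
    have h1 := x.1.2
    rw [map_add, map_add, h, show frob F K (frob F K x.1.1) + (x.2.1 + frob F K x.2.1) +
      (x.1.1 + x.2.1) = frob F K x.2.1 by linear_combination h1 + x.2.1 * h2]
    exact hUσ _ x.2.2
  · apply Subtype.ext
    exact CharTwo.add_cancel_right _ _
  · have h := hU _ x.2.2
    have h1 := x.1.2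
    have hd : frob F K (frob F K (x.1.1 + x.2.1)) + (x.1.1 + x.2.1) = frob F K x.2.1 := by
      rw [map_add, map_add, h]
      linear_combination h1 + x.2.1 * h2
    have h3 : frob F K (frob F K (frob F K x.2.1)) = x.2.1 := by
      rw [h, map_add, h]; linear_combination frob F K x.2.1 * h2
    refine Prod.ext (Subtype.ext ?_) (Subtype.ext ?_)
    · change x.1.1 + x.2.1 + frob F K (frob F K (frob F K (frob F K (x.1.1 + x.2.1)) +
        (x.1.1 + x.2.1))) = x.1.1
      rw [hd, h3]
      exact CharTwo.add_cancel_right _ _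
    · change frob F K (frob F K (frob F K (frob F K (x.1.1 + x.2.1)) + (x.1.1 + x.2.1))) = x.2.1
      rw [hd, h3]

/-- The sign s is the same at u, σu and σ²u = u + σu, and it is multiplicative along the radical;
thus s = s². -/
theorem asSign_curvePoly_of_radicalPoly_eq_zero {u : K} (hu : radicalPoly α α u = 0) :
    asSign (curvePoly F α α u) = 1 := by
  have h := frob_frob_of_radicalPoly_eq_zero F hα hno hu
  have h1 : radicalPoly α α ((frob F K ^ 2) u + u) = 0 := by
    rw [pow_two, AlgEquiv.mul_apply, h, show u + frob F K u + u = frob F K u by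
      linear_combination u * (CharTwo.two_eq_zero : (2 : K) = 0), ← radicalPoly_algEquiv, hu,
      map_zero]
  have h2 := asSign_curvePoly_add_of_radicalPoly_eq_zero F h1 (frob F K u)
  rw [add_comm, ← h] at h2
  have h3 := asSign_curvePoly_frob_pow F α α u 1
  rw [pow_one] at h3
  rw [← curvePoly_algEquiv, asSign_frob, h3, asSign_mul_self] at h2
  exact h2

theorem curveSum_self_sq_of_three_dvd (h3 : 3 ∣ Module.finrank F K)
    (hk : ∀ w : K, (frob F K ^ 2) w + w = 0 → asSign (curvePoly F α α w) = 1) :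
    curveSum F K α α ^ 2 =
      4 * Fintype.card K * Nat.card {w : K // (frob F K ^ 2) w + w = 0} := by
  rw [curveSum_sq_of_radical, card_radical_self F hα hno, card_radicalPoly_self_roots F hα hno h3]
  · push_cast; ring
  · intro w hw
    have h2 : (2 : K) = 0 := CharTwo.two_eq_zero
    set u := frob F K (frob F K ((frob F K ^ 2) w + w)) with hu
    have hu0 : radicalPoly α α u = 0 := by
      rw [hu, ← radicalPoly_algEquiv, ← radicalPoly_algEquiv, hw, map_zero, map_zero]
    have hker : (frob F K ^ 2) (w + u) + (w + u) = 0 := by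
      have h := frob_frob_of_radicalPoly_eq_zero F hα hno hw
      have h4 := frob_frob_of_radicalPoly_eq_zero F hα hno hu0
      have h5 : frob F K u = (frob F K ^ 2) w + w := by
        rw [hu, h, map_add, h]
        linear_combination frob F K ((frob F K ^ 2) w + w) * h2
      rw [map_add, pow_two (frob F K), AlgEquiv.mul_apply, AlgEquiv.mul_apply, h4, h5, pow_two,
        AlgEquiv.mul_apply]
      linear_combination (frob F K (frob F K w) + u + w) * h2
    have h6 := asSign_curvePoly_add_of_radicalPoly_eq_zero F (a := α) (b := α) (h := w + u)
      (by rw [hker, radicalPoly_zero]) u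
    rw [hk _ hker, asSign_curvePoly_of_radicalPoly_eq_zero F hα hno hu0, add_comm w,
      ← add_assoc, CharTwo.add_self_eq_zero, zero_add] at h6
    rw [h6, one_mul]

theorem curveSum_self_sq_of_three_dvd_of_odd (h3 : 3 ∣ Module.finrank F K)
    (h : Odd (Module.finrank F K)) :
    curveSum F K α α ^ 2 = 4 * (Fintype.card F : ℤ) ^ (Module.finrank F K + 1) := by
  rw [curveSum_self_sq_of_three_dvd F hα hno h3, card_frob_sq_add_of_odd F h,
    Module.card_eq_pow_finrank (K := F) (V := K)]
  · push_cast; ring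
  · intro w hw
    rw [curvePoly_of_frob_fixed F (frob_fixed_of_sq_fixed_of_odd F h (CharTwo.add_eq_zero.1 hw)),
      asSign_zero]

theorem curveSum_self_sq_of_three_dvd_of_four_dvd (h3 : 3 ∣ Module.finrank F K)
    (h : 4 ∣ Module.finrank F K) :
    curveSum F K α α ^ 2 = 4 * (Fintype.card F : ℤ) ^ (Module.finrank F K + 2) := by
  rw [curveSum_self_sq_of_three_dvd F hα hno h3, card_frob_sq_add_of_even F
    (even_iff_two_dvd.2 (Dvd.dvd.trans (by norm_num) h)),
    Module.card_eq_pow_finrank (K := F) (V := K)]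
  · push_cast; ring
  · intro w hw
    exact asSign_curvePoly_of_sq_fixed F h (CharTwo.add_eq_zero.1 hw) α α

end noRoot

/-! ### Cardano's formula: without a root in F, α and 1 have equal sign. -/

section cardano

theorem asSign_one {F : Type*} [Field F] [Fintype F] [CharP F 2] {r : ℕ}
    (hF : Fintype.card F = 2 ^ r) : asSign (1 : F) = (-1) ^ r := by
  let _ : Algebra (ZMod 2) F := ZMod.algebra F 2
  have hr : Module.finrank (ZMod 2) F = r := by
    have := Module.card_eq_pow_finrank (K := ZMod 2) (V := F)
    rw [hF, ZMod.card] at this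
    exact (Nat.pow_right_injective le_rfl this).symm
  rw [← asSign_trace (ZMod 2), ← map_one (algebraMap (ZMod 2) F), Algebra.trace_algebraMap, hr,
    nsmul_eq_mul, mul_one, CharTwo.natCast_eq_ite]
  split_ifs with h
  · rw [h.neg_one_pow, asSign_zero]
  · rw [(Nat.not_even_iff_odd.1 h).neg_one_pow, asSign_eq_neg_one_iff]
    decide

theorem cubic_of_cube_root {k : Type*} [Field k] [CharP k 2] {γ s t : k} (ht : t ^ 3 = s)
    (hs : s ^ 2 + γ * s = 1) : (t + t⁻¹) ^ 3 + (t + t⁻¹) + γ = 0 := by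
  have h2 : (2 : k) = 0 := CharTwo.two_eq_zero
  have ht0 : t ≠ 0 := by
    rintro rfl
    rw [← ht] at hs
    simp at hs
  have h1 : t * t⁻¹ = 1 := mul_inv_cancel₀ ht0
  have hγ : γ = t⁻¹ ^ 3 - t ^ 3 := by
    apply mul_left_cancel₀ (pow_ne_zero 3 ht0)
    rw [mul_sub, ← mul_pow, h1, one_pow, ht]
    linear_combination hs
  rw [hγ]
  linear_combination 3 * (t + t⁻¹) * h1 + (t⁻¹ ^ 3 + 2 * (t + t⁻¹)) * h2

variable (F : Type*) {K : Type*} [Field F] [Field K] [Algebra F K] [Fintype F] [Fintype K]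
  [CharP F 2] [CharP K 2]

include K in
-- If the signs differ, the resolvent s² + α⁻¹s = 1 has a solution that is a cube: in Fˣ when r is
-- odd (3 ∤ q - 1), in the norm-one group of order q + 1 when r is even (3 ∤ q + 1). Cardano then
-- yields a root in F.
theorem asSign_eq_asSign_one_of_no_root (hn : Even (Module.finrank F K)) {r : ℕ}
    (hF : Fintype.card F = 2 ^ r) {α : F} (hα : α ≠ 0) (hno : ∀ x : F, x ^ 3 + x + α⁻¹ ≠ 0) :
    asSign α = asSign (1 : F) := by
  by_contra hne
  have hmod : ∀ j : ℕ, 2 ^ (2 * j) % 3 = 1 := fun j => by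
    rw [pow_mul, Nat.pow_mod]; simp
  rcases asSign_eq_one_or α with h | h
  · have hr : Odd r := by
      rw [← Nat.not_even_iff_odd]
      intro hr
      rw [h, asSign_one hF, hr.neg_one_pow] at hne
      exact hne rfl
    obtain ⟨j, rfl⟩ := hr
    obtain ⟨y, hy⟩ := asSign_eq_one_iff.1 ((asSign_sq α).trans h)
    have hs : (y * α⁻¹) ^ 2 + α⁻¹ * (y * α⁻¹) = 1 := by
      rw [show (y * α⁻¹) ^ 2 + α⁻¹ * (y * α⁻¹) = (y ^ 2 + y) * α⁻¹ ^ 2 by ring, hy, ← mul_pow,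
        mul_inv_cancel₀ hα, one_pow]
    have hs0 : y * α⁻¹ ≠ 0 := by
      intro h0
      rw [h0] at hs
      simp at hs
    have hcard := FiniteField.pow_card_sub_one_eq_one _ hs0
    -- m inverts 3 modulo q - 1, so s^m is a cube root of s.
    obtain ⟨m, hm⟩ : ∃ m, m * 3 = (Fintype.card F - 1) * 2 + 1 := by
      have h1 := hmod j
      rw [hF, pow_succ]
      exact ⟨((2 ^ (2 * j) * 2 - 1) * 2 + 1) / 3, by omega⟩
    refine hno _ (cubic_of_cube_root (t := (y * α⁻¹) ^ m) ?_ hs)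
    rw [← pow_mul, hm, pow_succ, pow_mul, hcard, one_pow, one_mul]
  · have hr : Even r := by
      rw [← Nat.not_odd_iff_even]
      intro hr
      rw [h, asSign_one hF, hr.neg_one_pow] at hne
      exact hne rfl
    obtain ⟨j, hj⟩ := hr
    obtain ⟨y, hy⟩ := asSign_eq_one_iff.1 (asSign_algebraMap_of_even F hn (K := K) (α ^ 2))
    have hfy : frob F K y = y + 1 := by
      have h1 : (frob F K y) ^ 2 + frob F K y = y ^ 2 + y := by
        rw [← map_pow, ← map_add, hy, AlgEquiv.commutes]
      refine (artinSchreier_eq_iff.1 h1).resolve_left fun h2 => ?_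
      obtain ⟨c, rfl⟩ := (frob_fixed_iff F).1 h2
      refine asSign_eq_neg_one_iff.1 ((asSign_sq α).trans h) ⟨c, (algebraMap F K).injective ?_⟩
      rw [← hy, map_add, map_pow]
    set γ := algebraMap F K α⁻¹ with hγ
    have hαγ : algebraMap F K α * γ = 1 := by rw [hγ, ← map_mul, mul_inv_cancel₀ hα, map_one]
    set s := y * γ with hsdef
    have hs : s ^ 2 + γ * s = 1 := by
      rw [map_pow] at hy
      rw [hsdef]
      linear_combination γ ^ 2 * hy + (algebraMap F K α * γ + 1) * hαγ
    have hfs : frob F K s * s = 1 := by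
      rw [hsdef, map_mul, hfy, hγ, AlgEquiv.commutes, ← hγ]
      linear_combination hs
    rw [frob_apply, ← pow_succ] at hfs
    obtain ⟨m, hm⟩ : ∃ m, m * 3 = Fintype.card F + 1 + 1 := by
      have h1 := hmod j
      rw [hF, hj, ← two_mul]
      exact ⟨(2 ^ (2 * j) + 1 + 1) / 3, by omega⟩
    have ht : (s ^ m) ^ 3 = s := by rw [← pow_mul, hm, pow_succ, hfs, one_mul]
    have hroot := cubic_of_cube_root ht hs
    -- Frobenius inverts norm-one elements, so it swaps the two summands.
    have hfix : frob F K (s ^ m + (s ^ m)⁻¹) = s ^ m + (s ^ m)⁻¹ := by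
      have h1 : frob F K (s ^ m) = (s ^ m)⁻¹ := by
        rw [frob_apply]
        refine eq_inv_of_mul_eq_one_left ?_
        rw [← pow_succ, ← pow_mul, mul_comm, pow_mul, hfs, one_pow]
      rw [map_add, map_inv₀, h1, inv_inv, add_comm]
    exact frob_root_ne F hno hroot hfix

end cardano

/-! ### Exact values, by induction along prime divisors of the degree. -/

section values

theorem eq_of_sq_eq_of_modEq {p : ℕ} [hp : Fact p.Prime] (hp2 : p ≠ 2) {s x : ℤ}
    (hsq : s ^ 2 = x ^ 2) (hmod : s ≡ x [ZMOD p]) (hx : ¬ (p : ℤ) ∣ x) : s = x := by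
  refine (sq_eq_sq_iff_eq_or_eq_neg.1 hsq).resolve_right fun h => hx ?_
  have h1 : (p : ℤ) ∣ 2 * x := by
    have := hmod.dvd
    rw [h] at this
    rwa [two_mul, ← sub_neg_eq_add]
  refine (Int.Prime.dvd_mul' hp.out h1).resolve_left fun h2 => hp2 ?_
  exact (Nat.prime_dvd_prime_iff_eq hp.out Nat.prime_two).1 (by exact_mod_cast h2)

theorem not_dvd_mul_two_pow_mul {p : ℕ} [hp : Fact p.Prime] (hp2 : p ≠ 2) {e c : ℤ} (m : ℕ)
    (he : e = 1 ∨ e = -1) (hc : ¬ (p : ℤ) ∣ c) : ¬ (p : ℤ) ∣ e * 2 ^ m * c := by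
  have hpi : Prime (p : ℤ) := Nat.prime_iff_prime_int.1 hp.out
  intro h
  refine hc ((hpi.dvd_mul.1 h).resolve_left fun h1 => ?_)
  rcases hpi.dvd_mul.1 h1 with h2 | h2
  · refine hpi.not_dvd_one ?_
    rcases he with rfl | rfl
    · exact h2
    · exact (dvd_neg.2 h2).trans (by norm_num)
  · refine hp2 ((Nat.prime_dvd_prime_iff_eq hp.out Nat.prime_two).1 ?_)
    exact_mod_cast hpi.dvd_of_dvd_pow h2

theorem chi_eight_eq_one_or_neg_one {n : ℕ} (hn : Odd n) :
    ZMod.χ₈ n = 1 ∨ ZMod.χ₈ n = -1 := by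
  rw [ZMod.χ₈_nat_eq_if_mod_eight, if_neg (by have := Nat.odd_iff.1 hn; omega)]
  split_ifs <;> simp

/-- Propagation of the sign along an odd prime `p`, through Euler's criterion for `2`. -/
theorem chi_eight_pow_modEq {p d : ℕ} [hp : Fact p.Prime] (hp2 : p ≠ 2) (hd : Odd d) (r : ℕ) :
    ZMod.χ₈ (d * p : ℕ) ^ r * 2 ^ (r * ((d * p + 1) / 2)) ≡
      ZMod.χ₈ d ^ r * 2 ^ (r * ((d + 1) / 2)) [ZMOD p] := by
  have hpo : Odd p := hp.out.odd_of_ne_two hp2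
  rw [← ZMod.intCast_eq_intCast_iff]
  have h1 : ((ZMod.χ₈ p : ℤ) : ZMod p) = 2 ^ (p / 2) := by
    rw [← legendreSym.at_two hp2, legendreSym.eq_pow]; norm_num
  have h2 : (d * p + 1) / 2 = (d + 1) / 2 + d * (p / 2) := by
    obtain ⟨a, rfl⟩ := hd
    obtain ⟨b, rfl⟩ := hpo
    rw [show (2 * b + 1) / 2 = b by omega, show (2 * a + 1 + 1) / 2 = a + 1 by omega,
      show (2 * a + 1) * (2 * b + 1) + 1 = 2 * (a + 1 + (2 * a + 1) * b) by ring,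
      Nat.mul_div_cancel_left _ two_pos]
  have h3 : (ZMod.χ₈ p : ℤ) ^ (r * (d + 1)) = 1 := by
    obtain ⟨j, hj⟩ : Even (d + 1) := hd.add_one
    rw [hj, ← two_mul, mul_left_comm, pow_mul]
    rcases chi_eight_eq_one_or_neg_one hpo with h | h <;> simp [h]
  have h4 : ((ZMod.χ₈ p : ℤ) : ZMod p) ^ r * (2 ^ (p / 2)) ^ (r * d) = 1 := by
    rw [← h1, ← pow_add, ← Int.cast_pow, show r + r * d = r * (d + 1) by ring, h3, Int.cast_one]
  push_cast
  rw [map_mul, h2, mul_add r, pow_add, show r * (d * (p / 2)) = p / 2 * (r * d) by ring,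
    pow_mul 2 (p / 2)]
  push_cast
  linear_combination ((ZMod.χ₈ d : ℤ) : ZMod p) ^ r * 2 ^ (r * ((d + 1) / 2)) * h4

universe u

variable (F : Type*) [Field F] [Fintype F] [CharP F 2]

/-- The square fixes the sum up to sign, and the congruence modulo p with the subfield of index p
selects the sign. The factor c n records the extra radical, and p ∤ c n keeps the two candidates
distinct mod p. -/
theorem curveSum_of_odd {r : ℕ} (hF : Fintype.card F = 2 ^ r) (a b : F) (c : ℕ → ℤ)
    (hc1 : c 1 = 1)
    (hc : ∀ n : ℕ, Odd n → n ≠ 1 →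
      ∃ p : ℕ, p.Prime ∧ p ∣ n ∧ c n ≡ c (n / p) [ZMOD p] ∧ ¬ (p : ℤ) ∣ c n)
    (hsq : ∀ (K : Type u) [Field K] [Algebra F K] [Fintype K] [CharP K 2],
      Odd (Module.finrank F K) → curveSum F K a b ^ 2 =
        (Fintype.card F : ℤ) ^ (Module.finrank F K + 1) * c (Module.finrank F K) ^ 2)
    (n : ℕ) (hn : Odd n) :
    ∀ (K : Type u) [Field K] [Algebra F K] [Fintype K] [CharP K 2], Module.finrank F K = n →
      curveSum F K a b = ZMod.χ₈ n ^ r * 2 ^ (r * ((n + 1) / 2)) * c n := by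
  induction n using Nat.strong_induction_on with
  | _ n ih =>
  intro K _ _ _ _ hK
  rcases eq_or_ne n 1 with rfl | hn1
  · rw [curveSum_of_finrank_eq_one F hK, hF, hc1]
    simp
  obtain ⟨p, hp, ⟨d, rfl⟩, hcp, hcp'⟩ := hc n hn hn1
  rw [Nat.mul_div_cancel_left _ hp.pos] at hcp
  rw [mul_comm p d] at *
  have : Fact p.Prime := ⟨hp⟩
  have hdo : Odd d := (Nat.odd_mul.1 hn).1
  have hpo : Odd p := (Nat.odd_mul.1 hn).2
  have hp2 : p ≠ 2 := by rintro rfl; exact absurd hpo (by decide)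
  have hd0 : d ≠ 0 := by rintro rfl; exact absurd hdo (by decide)
  have := Fintype.ofFinite (frobFixedField F K d)
  have : CharP (frobFixedField F K d) 2 := charP_of_injective_algebraMap' F 2
  have hlt : d < d * p := lt_mul_of_one_lt_right (Nat.pos_of_ne_zero hd0) hp.one_lt
  have h1 := ih d hlt hdo (frobFixedField F K d) (finrank_frobFixedField F hd0 ⟨p, hK⟩)
  have h2 := curveSum_modEq F hp2 hK a b
  rw [h1] at h2
  have he : (ZMod.χ₈ (d * p : ℕ) : ℤ) ^ r = 1 ∨ (ZMod.χ₈ (d * p : ℕ) : ℤ) ^ r = -1 := by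
    rcases chi_eight_eq_one_or_neg_one hn with h | h <;> rw [h]
    · simp
    · exact neg_one_pow_eq_or ℤ r
  refine eq_of_sq_eq_of_modEq hp2 ?_ (h2.trans ?_) (not_dvd_mul_two_pow_mul hp2 _ he hcp')
  · rw [hsq K (hK ▸ hn), hK, hF, mul_pow, mul_pow]
    have h3 : ((ZMod.χ₈ (d * p : ℕ) : ℤ) ^ r) ^ 2 = 1 := by rcases he with h | h <;> rw [h] <;> simp
    rw [h3, one_mul]
    congr 1
    push_cast
    rw [← pow_mul, ← pow_mul, mul_assoc]
    congr 2
    have := Nat.odd_iff.1 hn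
    omega
  · exact ((chi_eight_pow_modEq hp2 hdo r).symm).mul hcp.symm

theorem curveSum_zero_one_of_odd {r : ℕ} (hF : Fintype.card F = 2 ^ r) (K : Type u) [Field K]
    [Algebra F K] [Fintype K] [CharP K 2] (hn : Odd (Module.finrank F K)) :
    curveSum F K 0 1 = ZMod.χ₈ (Module.finrank F K) ^ r *
      2 ^ (r * ((Module.finrank F K + 1) / 2)) := by
  have := curveSum_of_odd F hF 0 1 (fun _ => 1) rfl (fun n _ hn1 => ?_)
    (fun K _ _ _ _ h => ?_) _ hn K rfl
  · rw [this, mul_one]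
  · refine ⟨n.minFac, Nat.minFac_prime hn1, n.minFac_dvd, rfl, fun h => ?_⟩
    exact (Nat.minFac_prime hn1).one_lt.ne' (by exact_mod_cast Int.eq_one_of_dvd_one (by positivity) h)
  · rw [one_pow, mul_one]
    exact curveSum_sq_of_odd F h fun u hu => by simpa [radicalPoly] using hu

theorem curveSum_self_of_no_root_of_odd {r : ℕ} (hF : Fintype.card F = 2 ^ r) {α : F}
    (hα : α ≠ 0) (hno : ∀ x : F, x ^ 3 + x + α⁻¹ ≠ 0) (K : Type u) [Field K]
    [Algebra F K] [Fintype K] [CharP K 2] (hn : Odd (Module.finrank F K)) :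
    curveSum F K α α = ZMod.χ₈ (Module.finrank F K) ^ r *
      2 ^ (r * ((Module.finrank F K + 1) / 2)) * if 3 ∣ Module.finrank F K then -2 else 1 := by
  refine curveSum_of_odd F hF α α (fun n => if 3 ∣ n then -2 else 1) (by norm_num)
    (fun n _ hn1 => ?_) (fun K _ _ _ _ h => ?_) _ hn K rfl
  · by_cases h3 : 3 ∣ n
    -- Since -2 ≡ 1 mod 3, the congruence holds whether or not 3 divides n/3.
    · refine ⟨3, Nat.prime_three, h3, ?_, ?_⟩
      · simp only [h3, if_true]
        split_ifs <;> decide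
      · simp only [h3, if_true]; decide
    · refine ⟨n.minFac, Nat.minFac_prime hn1, n.minFac_dvd, ?_, fun h => ?_⟩
      · simp only [h3, if_false]
        rw [if_neg fun h => h3 (h.trans (Nat.div_dvd_of_dvd n.minFac_dvd))]
      · simp only [h3, if_false] at h
        exact (Nat.minFac_prime hn1).one_lt.ne'
          (by exact_mod_cast Int.eq_one_of_dvd_one (by positivity) h)
  · split_ifs with h3
    · rw [curveSum_self_sq_of_three_dvd_of_odd F hα hno h3 h]; ring
    · rw [one_pow, mul_one]
      exact curveSum_sq_of_odd F h fun u hu => radicalPoly_self_injective F hα hno h3 hu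

omit [Fintype F] in
theorem asSign_natCast (k : ℕ) : asSign (k : F) = if Even k then 1 else asSign (1 : F) := by
  rw [CharTwo.natCast_eq_ite]; split_ifs <;> simp

/-- For 3 ∤ k the direct evaluation applies. Each factor 3 of k is removed by the congruence mod 3,
where 4 ≡ 1 and -2 ≡ 1. -/
theorem curveSum_self_of_no_root_of_four_mul {r : ℕ} (hF : Fintype.card F = 2 ^ r) {α : F}
    (hα : α ≠ 0) (hno : ∀ x : F, x ^ 3 + x + α⁻¹ ≠ 0) (k : ℕ) :
    ∀ (K : Type u) [Field K] [Algebra F K] [Fintype K] [CharP K 2], Module.finrank F K = 4 * k →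
      curveSum F K α α = asSign (k : F) * 2 ^ (r * (2 * k + 1)) * if 3 ∣ k then -2 else 1 := by
  induction k using Nat.strong_induction_on with
  | _ k ih =>
  intro K _ _ _ _ hK
  have hk0 : k ≠ 0 := by
    have := Module.finrank_pos (R := F) (M := K)
    omega
  split_ifs with h3
  · obtain ⟨j, rfl⟩ := h3
    have h3 : 3 ∣ Module.finrank F K := ⟨4 * j, by rw [hK]; ring⟩
    have hK' : Module.finrank F K = 4 * j * 3 := by rw [hK]; ring
    have hj : 4 * j ≠ 0 := by omega
    have : Fact (Nat.Prime 3) := ⟨Nat.prime_three⟩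
    have := Fintype.ofFinite (frobFixedField F K (4 * j))
    have : CharP (frobFixedField F K (4 * j)) 2 := charP_of_injective_algebraMap' F 2
    have h1 := ih j (by omega) (frobFixedField F K (4 * j))
      (finrank_frobFixedField F hj ⟨3, hK'⟩)
    have h2 := curveSum_modEq F (by norm_num) hK' α α
    rw [h1] at h2
    have hs : asSign ((3 * j : ℕ) : F) = asSign (j : F) := by
      rw [asSign_natCast, asSign_natCast]
      refine if_congr ?_ rfl rfl
      rw [Nat.even_mul]
      simp [show ¬ Even 3 by decide]
    refine eq_of_sq_eq_of_modEq (p := 3) (by norm_num) ?_ (h2.trans ?_)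
      (not_dvd_mul_two_pow_mul (by norm_num) _ (asSign_eq_one_or _) (by decide))
    · rw [curveSum_self_sq_of_three_dvd_of_four_dvd F hα hno h3 ⟨_, hK⟩, hF, hK, mul_pow, mul_pow,
        sq (asSign _), asSign_mul_self]
      push_cast
      rw [← pow_mul, ← pow_mul]
      ring
    · rw [hs]
      refine Int.ModEq.mul (Int.ModEq.mul_left _ ?_) (by split_ifs <;> decide)
      have h4 : (2 : ℤ) ^ (r * (2 * (3 * j) + 1)) = 2 ^ (r * (2 * j + 1)) * (2 ^ 2) ^ (r * (2 * j)) := by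
        rw [← pow_mul, ← pow_add]; ring
      rw [h4]
      have h5 : (1 : ℤ) ≡ 2 ^ 2 [ZMOD (3 : ℕ)] := by decide
      simpa using (Int.ModEq.mul_left (2 ^ (r * (2 * j + 1))) (h5.pow (r * (2 * j))))
  · rw [curveSum_self_of_four_mul F hK fun u hu => radicalPoly_self_injective F hα hno
      (by rw [hK]; omega) hu, mul_one, hF]
    push_cast
    rw [← pow_mul]
    congr 1
    rw [asSign_natCast, CharTwo.natCast_eq_ite]
    split_ifs with hk
    · simp
    · rw [mul_one]
      exact asSign_eq_asSign_one_of_no_root F (K := K) (by rw [hK]; exact ⟨2 * k, by ring⟩) hF hα hno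

end values

/-! ### From projective points to the exponential sum. -/

section points

theorem ncard_C3Points {K : Type*} [Field K] [Fintype K] [CharP K 2] {r : ℕ} (hr : r ≠ 0)
    {a : K} (ha : a ≠ 0) : ((C3Points r a).ncard : ℤ) = Fintype.card K + 1 +
      ∑ x : K, asSign (a * (x ^ (2 ^ (r + 1) + 1) + x ^ (2 ^ r + 2) + x ^ (2 ^ r + 1) + x ^ 2)) := by
  classical
  set f : K → K := fun x => a * (x ^ (2 ^ (r + 1) + 1) + x ^ (2 ^ r + 2) + x ^ (2 ^ r + 1) + x ^ 2)
    with hf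
  have hv1 : ∀ x y : K, (![x, y, 1] : Fin 3 → K) ≠ 0 := fun x y h => by
    simpa using congrFun h 2
  have hv0 : (![0, 1, 0] : Fin 3 → K) ≠ 0 := fun h => by simpa using congrFun h 1
  set φ : K × K → Projectivization K (Fin 3 → K) := fun p =>
    Projectivization.mk K ![p.1, p.2, 1] (hv1 p.1 p.2) with hφ
  have hφinj : Function.Injective φ := by
    intro p p' h
    obtain ⟨c, hc⟩ := (Projectivization.mk_eq_mk_iff' K _ _ _ _).1 h
    have h0 := congrFun hc 0
    have h1 := congrFun hc 1
    have h2 := congrFun hc 2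
    simp at h0 h1 h2
    subst h2
    exact Prod.ext (by simpa using h0.symm) (by simpa using h1.symm)
  have hset : C3Points r a = insert (Projectivization.mk K ![0, 1, 0] hv0)
      (φ '' {p : K × K | p.2 ^ 2 + p.2 = f p.1}) := by
    ext P
    induction P using Projectivization.ind with
    | h v hv =>
    rw [mk_mem_C3Points, Set.mem_insert_iff, Set.mem_image]
    by_cases hz : v 2 = 0
    · have hq : 2 ^ r - 1 ≠ 0 := by
        have := Nat.one_lt_two_pow hr
        omega
      have hq' : 2 ^ (r + 1) - 1 ≠ 0 := by
        have := Nat.one_lt_two_pow (n := r + 1) (by omega)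
        omega
      -- On Z = 0 only the pure power of X survives, because r ≠ 0 makes every exponent of Z
      -- positive; [0 : 1 : 0] is the only point at infinity.
      have hl : C3Equation r a v ↔ v 0 = 0 := by
        rw [C3Equation, hz, zero_pow hq, zero_pow hq', zero_pow (by positivity),
          zero_pow (by positivity)]
        simp [ha, eq_comm (a := (0 : K))]
      have hr' : ¬ ∃ x ∈ {p : K × K | p.2 ^ 2 + p.2 = f p.1}, φ x = Projectivization.mk K v hv := by
        rintro ⟨p, -, h⟩
        obtain ⟨c, hc⟩ := (Projectivization.mk_eq_mk_iff' K _ _ _ _).1 h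
        have h2 := congrFun hc 2
        simp [hz] at h2
      rw [hl, or_iff_left hr', Projectivization.mk_eq_mk_iff']
      constructor
      · intro h0
        refine ⟨v 1, ?_⟩
        ext i
        fin_cases i <;> simp [h0, hz]
      · rintro ⟨c, hc⟩
        simpa using (congrFun hc 0).symm
    · have hs : (v 2)⁻¹ • v = ![v 0 / v 2, v 1 / v 2, 1] := by
        ext i
        fin_cases i <;> simp [hz, div_eq_inv_mul]
      have hmk : Projectivization.mk K v hv = φ (v 0 / v 2, v 1 / v 2) := by
        rw [hφ, Projectivization.mk_eq_mk_iff']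
        refine ⟨v 2, ?_⟩
        rw [← hs, smul_smul, mul_inv_cancel₀ hz, one_smul]
      have hne : ¬ φ (v 0 / v 2, v 1 / v 2) = Projectivization.mk K ![0, 1, 0] hv0 := by
        intro h
        obtain ⟨c, hc⟩ := (Projectivization.mk_eq_mk_iff' K _ _ _ _).1 h
        have h2 := congrFun hc 2
        simp at h2
      rw [hmk, or_iff_right hne, ← C3Equation_smul r a v (inv_ne_zero hz), hs]
      simp only [hφinj.eq_iff, exists_eq_right, Set.mem_ofPred_eq]
      simp [C3Equation, hf]
  have hnot : Projectivization.mk K ![0, 1, 0] hv0 ∉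
      φ '' {p : K × K | p.2 ^ 2 + p.2 = f p.1} := by
    rintro ⟨p, -, h⟩
    obtain ⟨c, hc⟩ := (Projectivization.mk_eq_mk_iff' K _ _ _ _).1 h
    have h2 := congrFun hc 2
    simp at h2
  have hcard : ({p : K × K | p.2 ^ 2 + p.2 = f p.1}.ncard : ℤ) =
      Fintype.card K + ∑ x, asSign (f x) := by
    have h1 : {p : K × K | p.2 ^ 2 + p.2 = f p.1} =
        ((univ : Finset K).sigma fun x => univ.filter fun y : K => y ^ 2 + y = f x).map
          (Equiv.sigmaEquivProd K K).toEmbedding := by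
      ext p
      simp only [Set.mem_ofPred_eq, coe_map, Set.mem_image, mem_coe, mem_sigma, mem_filter,
        mem_univ, true_and]
      refine ⟨fun h => ⟨⟨p.1, p.2⟩, h, rfl⟩, ?_⟩
      rintro ⟨⟨x, y⟩, h, rfl⟩
      exact h
    rw [h1, Set.ncard_coe_finset, card_map, card_sigma]
    rw [Nat.cast_sum, sum_congr rfl fun x _ => card_artinSchreier_fiber (f x), sum_add_distrib]
    simp
  rw [hset, Set.ncard_insert_of_notMem hnot, Set.ncard_image_of_injective _ hφinj]
  push_cast
  rw [hcard]
  ring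

end points

/-! ### Counting roots of the cubic from one known root. -/

section roots

variable {F : Type*} [Field F] [CharP F 2]

/-- Dividing out x + u leaves a quadratic that is Artin–Schreier in x/u. -/
theorem cubic_eq_zero_iff {α u : F} (hα : α ≠ 0) (hu : u ^ 3 + u + α⁻¹ = 0) (x : F) :
    x ^ 3 + x + α⁻¹ = 0 ↔ x = u ∨ (x / u) ^ 2 + x / u = ((u + 1) / u) ^ 2 := by
  have h2 : (2 : F) = 0 := CharTwo.two_eq_zero
  have hu0 := (cubic_root_ne F hα hu).1
  rw [show x ^ 3 + x + α⁻¹ = (x + u) * (x ^ 2 + u * x + u ^ 2 + 1) by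
    linear_combination hu - (u ^ 3 + u + u * x ^ 2 + u ^ 2 * x) * h2, mul_eq_zero,
    CharTwo.add_eq_zero]
  refine or_congr_right ?_
  rw [show x ^ 2 + u * x + u ^ 2 + 1 = u ^ 2 * ((x / u) ^ 2 + x / u + ((u + 1) / u) ^ 2) by
    field_simp
    linear_combination -u * h2, mul_eq_zero, CharTwo.add_eq_zero]
  simp [hu0]

theorem cubicRootCount_of_root [Fintype F] {α u : F} (hα : α ≠ 0) (hu : u ^ 3 + u + α⁻¹ = 0) :
    cubicRootCount α = if asSign ((u + 1) / u) = 1 then 3 else 1 := by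
  obtain ⟨h0, h1⟩ := cubic_root_ne F hα hu
  unfold cubicRootCount
  simp_rw [cubic_eq_zero_iff hα hu]
  split_ifs with h
  · obtain ⟨y, hy⟩ := asSign_eq_one_iff.1 ((asSign_sq _).trans h)
    have hset : {x : F | x = u ∨ (x / u) ^ 2 + x / u = ((u + 1) / u) ^ 2} =
        {u, u * y, u * y + u} := by
      ext x
      simp only [← hy, artinSchreier_eq_iff, Set.mem_ofPred_eq, Set.mem_insert_iff,
        Set.mem_singleton_iff, div_eq_iff h0, add_mul, one_mul, mul_comm y]
    have he : (u + 1) / u ≠ 0 := div_ne_zero h1 h0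
    have hy0 : y ≠ 0 := by
      rintro rfl
      exact pow_ne_zero 2 he (by rw [← hy]; ring)
    have hy1 : y ≠ 1 := by
      rintro rfl
      exact pow_ne_zero 2 he (by rw [← hy, one_pow, CharTwo.add_self_eq_zero])
    rw [hset, Set.ncard_eq_three]
    refine ⟨_, _, _, ?_, ?_, ?_, rfl⟩
    · intro h; exact hy1 (by simpa [h0] using h.symm)
    · intro h; simp [h0, hy0] at h
    · intro h; simp [h0] at h
  · have h' : asSign (((u + 1) / u) ^ 2) = -1 := by
      rw [asSign_sq]; exact (asSign_eq_one_or _).resolve_left h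
    have hset : {x : F | x = u ∨ (x / u) ^ 2 + x / u = ((u + 1) / u) ^ 2} = {u} := by
      ext x
      simp only [Set.mem_ofPred_eq, Set.mem_singleton_iff, or_iff_left_iff_imp]
      intro hx
      exact absurd ⟨_, hx⟩ (asSign_eq_neg_one_iff.1 h')
    rw [hset, Set.ncard_singleton]

omit [CharP F 2] in
theorem no_root_of_cubicRootCount_eq_zero [Finite F] {α : F} (h : cubicRootCount α = 0) (x : F) :
    x ^ 3 + x + α⁻¹ ≠ 0 := by
  intro hx
  rw [cubicRootCount, Set.ncard_eq_zero] at h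
  have : x ∈ {x : F | x ^ 3 + x + α⁻¹ = 0} := hx
  rw [h] at this
  exact this

omit [CharP F 2] in
theorem exists_root_of_cubicRootCount_ne_zero {α : F} (h : cubicRootCount α ≠ 0) :
    ∃ x : F, x ^ 3 + x + α⁻¹ = 0 :=
  Set.nonempty_of_ncard_ne_zero h

end roots

/-! ### Assembly of the cases. -/

section assembly

variable (F : Type*) {K : Type*} [Field F] [Field K] [Algebra F K] [Fintype F] [Fintype K]
  [CharP K 2]

theorem ncard_C3Points_eq_curveSum {r n : ℕ} (hr : r ≠ 0) (hF : Fintype.card F = 2 ^ r)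
    (hK : Fintype.card K = 2 ^ (r * n)) {α : F} (hα : α ≠ 0) :
    ((C3Points r (algebraMap F K α)).ncard : ℤ) = 2 ^ (r * n) + 1 + curveSum F K α α := by
  rw [ncard_C3Points hr (by rwa [map_ne_zero]), hK, curveSum]
  push_cast
  congr 1
  refine sum_congr rfl fun x _ => ?_
  rw [curvePoly, frob_apply, hF]
  congr 1
  ring

theorem chi_eight_eq_one {n : ℕ} (h : n % 8 = 1 ∨ n % 8 = 7) : ZMod.χ₈ n = 1 := by
  rw [ZMod.χ₈_nat_eq_if_mod_eight, if_neg (by omega), if_pos h]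

theorem chi_eight_eq_neg_one {n : ℕ} (h : n % 8 = 3 ∨ n % 8 = 5) : ZMod.χ₈ n = -1 := by
  rw [ZMod.χ₈_nat_eq_if_mod_eight, if_neg (by omega), if_neg (by omega)]

theorem chi_eight_pow_of_even {n r : ℕ} (hn : Odd n) (hr : Even r) : ZMod.χ₈ n ^ r = 1 := by
  rcases chi_eight_eq_one_or_neg_one hn with h | h <;> rw [h]
  · exact one_pow r
  · exact hr.neg_one_pow

end assembly

theorem mainTheorem5 {F K : Type*} [Field F] [Field K] [Algebra F K] (r n : ℕ)
    (hr : 1 ≤ r) (hn : 1 ≤ n) (hF : Nat.card F = 2 ^ r) (hK : Nat.card K = 2 ^ (r * n))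
    (α : F) (hα : α ≠ 0) (N : ℤ) (hN : N = ((C3Points r (algebraMap F K α)).ncard : ℤ)) :
    -- three roots, `r` odd
    (cubicRootCount α = 3 → Odd r →
      (n % 8 ∈ ({1, 7} : Set ℕ) → N = (2 ^ (r * n) + 1) + 2 ^ (r * (n + 1) / 2)) ∧
      (n % 8 ∈ ({3, 5} : Set ℕ) → N = (2 ^ (r * n) + 1) - 2 ^ (r * (n + 1) / 2)) ∧
      (n % 8 ∈ ({2, 6} : Set ℕ) → N = 2 ^ (r * n) + 1) ∧
      (n % 8 = 4 → N = (2 ^ (r * n) + 1) + 2 ^ (r * (n + 2) / 2 + 1)) ∧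
      (n % 8 = 0 → N = (2 ^ (r * n) + 1) - 2 ^ (r * (n + 2) / 2 + 1))) ∧
    -- three roots, `r` even
    (cubicRootCount α = 3 → Even r →
      (n % 8 ∈ ({1, 3, 5, 7} : Set ℕ) → N = (2 ^ (r * n) + 1) + 2 ^ (r * (n + 1) / 2)) ∧
      (n % 8 ∈ ({2, 6} : Set ℕ) → N = 2 ^ (r * n) + 1) ∧
      (n % 8 ∈ ({0, 4} : Set ℕ) → N = (2 ^ (r * n) + 1) - 2 ^ (r * (n + 2) / 2 + 1))) ∧
    -- one root, `r` odd
    (cubicRootCount α = 1 → Odd r →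
      (n % 8 ∈ ({1, 7} : Set ℕ) → N = (2 ^ (r * n) + 1) + 2 ^ (r * (n + 1) / 2)) ∧
      (n % 8 ∈ ({3, 5} : Set ℕ) → N = (2 ^ (r * n) + 1) - 2 ^ (r * (n + 1) / 2)) ∧
      (n % 8 ∈ ({2, 4, 6} : Set ℕ) → N = 2 ^ (r * n) + 1) ∧
      (n % 8 = 0 → N = (2 ^ (r * n) + 1) - 2 ^ (r * (n + 2) / 2 + 1))) ∧
    -- one root, `r` even
    (cubicRootCount α = 1 → Even r →
      (n % 8 ∈ ({1, 3, 5, 7} : Set ℕ) → N = (2 ^ (r * n) + 1) + 2 ^ (r * (n + 1) / 2)) ∧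
      (n % 8 ∈ ({2, 4, 6} : Set ℕ) → N = 2 ^ (r * n) + 1) ∧
      (n % 8 = 0 → N = (2 ^ (r * n) + 1) - 2 ^ (r * (n + 2) / 2 + 1))) ∧
    -- no root, `r` odd
    (cubicRootCount α = 0 → Odd r →
      (n % 24 ∈ ({1, 7, 17, 23} : Set ℕ) →
        N = (2 ^ (r * n) + 1) + 2 ^ (r * (n + 1) / 2)) ∧
      (n % 24 ∈ ({5, 11, 13, 19} : Set ℕ) →
        N = (2 ^ (r * n) + 1) - 2 ^ (r * (n + 1) / 2)) ∧
      (n % 24 ∈ ({3, 21} : Set ℕ) →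
        N = (2 ^ (r * n) + 1) + 2 ^ (r * (n + 1) / 2 + 1)) ∧
      (n % 24 ∈ ({9, 15} : Set ℕ) →
        N = (2 ^ (r * n) + 1) - 2 ^ (r * (n + 1) / 2 + 1)) ∧
      (n % 24 ∈ ({2, 6, 10, 14, 18, 22} : Set ℕ) → N = 2 ^ (r * n) + 1) ∧
      (n % 24 ∈ ({8, 16} : Set ℕ) → N = (2 ^ (r * n) + 1) + 2 ^ (r * (n + 2) / 2)) ∧
      (n % 24 ∈ ({4, 20} : Set ℕ) → N = (2 ^ (r * n) + 1) - 2 ^ (r * (n + 2) / 2)) ∧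
      (n % 24 = 12 → N = (2 ^ (r * n) + 1) + 2 ^ (r * (n + 2) / 2 + 1)) ∧
      (n % 24 = 0 → N = (2 ^ (r * n) + 1) - 2 ^ (r * (n + 2) / 2 + 1))) ∧
    -- no root, `r` even
    (cubicRootCount α = 0 → Even r →
      (n % 24 ∈ ({1, 5, 7, 11, 13, 17, 19, 23} : Set ℕ) →
        N = (2 ^ (r * n) + 1) + 2 ^ (r * (n + 1) / 2)) ∧
      (n % 24 ∈ ({3, 9, 15, 21} : Set ℕ) →
        N = (2 ^ (r * n) + 1) - 2 ^ (r * (n + 1) / 2 + 1)) ∧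
      (n % 24 ∈ ({2, 6, 10, 14, 18, 22} : Set ℕ) → N = 2 ^ (r * n) + 1) ∧
      (n % 24 ∈ ({4, 8, 16, 20} : Set ℕ) →
        N = (2 ^ (r * n) + 1) + 2 ^ (r * (n + 2) / 2)) ∧
      (n % 24 ∈ ({0, 12} : Set ℕ) →
        N = (2 ^ (r * n) + 1) - 2 ^ (r * (n + 2) / 2 + 1))) := by
  classical
  have hr0 : r ≠ 0 := by omega
  have : Finite F := Nat.finite_of_card_ne_zero (by rw [hF]; positivity)
  have : Finite K := Nat.finite_of_card_ne_zero (by rw [hK]; positivity)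
  have := Fintype.ofFinite F
  have := Fintype.ofFinite K
  rw [Nat.card_eq_fintype_card] at hF hK
  have hp : Fact (Nat.Prime 2) := ⟨Nat.prime_two⟩
  have : CharP F 2 := charP_of_card_eq_prime_pow hF
  have : CharP K 2 := charP_of_injective_algebraMap' F 2
  have hfin : Module.finrank F K = n := by
    have h := Module.card_eq_pow_finrank (K := F) (V := K)
    rw [hF, hK, ← pow_mul] at h
    exact (Nat.eq_of_mul_eq_mul_left hr (Nat.pow_right_injective le_rfl h)).symm
  rw [ncard_C3Points_eq_curveSum F hr0 hF hK hα] at hN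
  have htwo : n % 4 = 2 → N = 2 ^ (r * n) + 1 := fun h => by
    rw [hN, curveSum_eq_zero_of_mod_four_eq_two F (hfin.symm ▸ h) hα, add_zero]
  -- In the statement the natural division applies to the whole product; it is exact for odd n.
  have hdiv : Odd n → r * ((n + 1) / 2) = r * (n + 1) / 2 := fun h =>
    (Nat.mul_div_assoc r h.add_one.two_dvd).symm
  have hdiv4 : ∀ k, n = 4 * k → r * (2 * k + 1) = r * (n + 2) / 2 := by
    rintro k rfl
    rw [show 4 * k + 2 = 2 * (2 * k + 1) by ring, mul_left_comm, Nat.mul_div_cancel_left _ two_pos]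
  have hone := asSign_one hF
  have rooted_odd : cubicRootCount α ≠ 0 → Odd n →
      N = 2 ^ (r * n) + 1 + ZMod.χ₈ n ^ r * 2 ^ (r * (n + 1) / 2) := by
    intro h hn
    obtain ⟨u, hu⟩ := exists_root_of_cubicRootCount_ne_zero h
    rw [hN, curveSum_self_of_root_of_odd F hα hu (hfin.symm ▸ hn),
      curveSum_zero_one_of_odd F hF K (hfin.symm ▸ hn), hfin, hdiv hn]
  -- The first factor is 1 + the sign of k(u + 1)/u: it is 2 if k is even or all three roots lie in
  -- F, and 0 otherwise.
  have rooted_four : cubicRootCount α ≠ 0 → ∀ k, n = 4 * k →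
      N = 2 ^ (r * n) + 1 - (1 + if Even k ∨ cubicRootCount α = 3 then 1 else -1) *
        (if Even k then 1 else (-1) ^ r) * 2 ^ (r * (n + 2) / 2) := by
    intro h k hk
    obtain ⟨u, hu⟩ := exists_root_of_cubicRootCount_ne_zero h
    rw [hN, curveSum_self_of_root_of_four_mul F hα hu (hfin.trans hk), asSign_natCast, hone, hF,
      cubicRootCount_of_root hα hu, CharTwo.natCast_eq_ite, ← hdiv4 k hk]
    push_cast
    rw [← pow_mul]
    by_cases hke : Even k
    · simp only [hke, if_true, true_or, zero_mul, asSign_zero]; ring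
    · rcases asSign_eq_one_or ((u + 1) / u) with h1 | h1
      · simp [hke, h1]; ring
      · simp [hke, h1]
  have noroot_odd : cubicRootCount α = 0 → Odd n →
      N = 2 ^ (r * n) + 1 + ZMod.χ₈ n ^ r * 2 ^ (r * (n + 1) / 2) *
        if 3 ∣ n then -2 else 1 := by
    intro h hn
    rw [hN, curveSum_self_of_no_root_of_odd F hF hα (no_root_of_cubicRootCount_eq_zero h) K
      (hfin.symm ▸ hn), hfin, hdiv hn]
  have noroot_four : cubicRootCount α = 0 → ∀ k, n = 4 * k →
      N = 2 ^ (r * n) + 1 + (if Even k then 1 else (-1) ^ r) * 2 ^ (r * (n + 2) / 2) *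
        if 3 ∣ k then -2 else 1 := by
    intro h k hk
    rw [hN, curveSum_self_of_no_root_of_four_mul F hF hα (no_root_of_cubicRootCount_eq_zero h) k K
      (hfin.trans hk), asSign_natCast, hone, hdiv4 k hk]
  clear hN
  simp only [Set.mem_insert_iff, Set.mem_singleton_iff]
  refine ⟨fun hc hr => ?_, fun hc hr => ?_, fun hc hr => ?_, fun hc hr => ?_, fun hc hr => ?_,
    fun hc hr => ?_⟩
  · have hc0 : cubicRootCount α ≠ 0 := by omega
    refine ⟨fun h => ?_, fun h => ?_, fun h => ?_, fun h => ?_, fun h => ?_⟩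
    · rw [rooted_odd hc0 (Nat.odd_iff.2 (by omega)), chi_eight_eq_one h, one_pow, one_mul]
    · rw [rooted_odd hc0 (Nat.odd_iff.2 (by omega)), chi_eight_eq_neg_one h, hr.neg_one_pow]
      ring
    · exact htwo (by omega)
    · rw [rooted_four hc0 (n / 4) (by omega), if_pos (Or.inr hc),
        if_neg (by rw [Nat.even_iff]; omega), hr.neg_one_pow]
      ring
    · rw [rooted_four hc0 (n / 4) (by omega), if_pos (Or.inr hc),
        if_pos (by rw [Nat.even_iff]; omega)]
      ring
  · have hc0 : cubicRootCount α ≠ 0 := by omega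
    refine ⟨fun h => ?_, fun h => ?_, fun h => ?_⟩
    · have hn : Odd n := Nat.odd_iff.2 (by omega)
      rw [rooted_odd hc0 hn, chi_eight_pow_of_even hn hr, one_mul]
    · exact htwo (by omega)
    · rw [rooted_four hc0 (n / 4) (by omega), if_pos (Or.inr hc), hr.neg_one_pow, ite_self]
      ring
  · have hc0 : cubicRootCount α ≠ 0 := by omega
    refine ⟨fun h => ?_, fun h => ?_, fun h => ?_, fun h => ?_⟩
    · rw [rooted_odd hc0 (Nat.odd_iff.2 (by omega)), chi_eight_eq_one h, one_pow, one_mul]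
    · rw [rooted_odd hc0 (Nat.odd_iff.2 (by omega)), chi_eight_eq_neg_one h, hr.neg_one_pow]
      ring
    · by_cases h4 : n % 8 = 4
      · rw [rooted_four hc0 (n / 4) (by omega), if_neg (by rw [Nat.even_iff]; omega)]
        ring
      · exact htwo (by omega)
    · have hk : Even (n / 4) := by rw [Nat.even_iff]; omega
      rw [rooted_four hc0 (n / 4) (by omega), if_pos (Or.inl hk), if_pos hk]
      ring
  · have hc0 : cubicRootCount α ≠ 0 := by omega
    refine ⟨fun h => ?_, fun h => ?_, fun h => ?_⟩
    · have hn : Odd n := Nat.odd_iff.2 (by omega)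
      rw [rooted_odd hc0 hn, chi_eight_pow_of_even hn hr, one_mul]
    · by_cases h4 : n % 8 = 4
      · rw [rooted_four hc0 (n / 4) (by omega), if_neg (by rw [Nat.even_iff]; omega)]
        ring
      · exact htwo (by omega)
    · have hk : Even (n / 4) := by rw [Nat.even_iff]; omega
      rw [rooted_four hc0 (n / 4) (by omega), if_pos (Or.inl hk), if_pos hk]
      ring
  · refine ⟨fun h => ?_, fun h => ?_, fun h => ?_, fun h => ?_, fun h => ?_, fun h => ?_,
      fun h => ?_, fun h => ?_, fun h => ?_⟩
    · rw [noroot_odd hc (Nat.odd_iff.2 (by omega)), chi_eight_eq_one (by omega), one_pow,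
        if_neg (by omega)]
      ring
    · rw [noroot_odd hc (Nat.odd_iff.2 (by omega)), chi_eight_eq_neg_one (by omega),
        hr.neg_one_pow, if_neg (by omega)]
      ring
    · rw [noroot_odd hc (Nat.odd_iff.2 (by omega)), chi_eight_eq_neg_one (by omega),
        hr.neg_one_pow, if_pos (by omega)]
      ring
    · rw [noroot_odd hc (Nat.odd_iff.2 (by omega)), chi_eight_eq_one (by omega), one_pow,
        if_pos (by omega)]
      ring
    · exact htwo (by omega)
    · rw [noroot_four hc (n / 4) (by omega), if_pos (by rw [Nat.even_iff]; omega),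
        if_neg (by omega)]
      ring
    · rw [noroot_four hc (n / 4) (by omega), if_neg (by rw [Nat.even_iff]; omega),
        if_neg (by omega), hr.neg_one_pow]
      ring
    · rw [noroot_four hc (n / 4) (by omega), if_neg (by rw [Nat.even_iff]; omega),
        if_pos (by omega), hr.neg_one_pow]
      ring
    · rw [noroot_four hc (n / 4) (by omega), if_pos (by rw [Nat.even_iff]; omega),
        if_pos (by omega)]
      ring
  · refine ⟨fun h => ?_, fun h => ?_, fun h => ?_, fun h => ?_, fun h => ?_⟩
    · have hn : Odd n := Nat.odd_iff.2 (by omega)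
      rw [noroot_odd hc hn, chi_eight_pow_of_even hn hr, if_neg (by omega)]
      ring
    · have hn : Odd n := Nat.odd_iff.2 (by omega)
      rw [noroot_odd hc hn, chi_eight_pow_of_even hn hr, if_pos (by omega)]
      ring
    · exact htwo (by omega)
    · rw [noroot_four hc (n / 4) (by omega), hr.neg_one_pow, ite_self, if_neg (by omega)]
      ring
    · rw [noroot_four hc (n / 4) (by omega), hr.neg_one_pow, ite_self, if_pos (by omega)]
      ring
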